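/- For a probability law $P$ on $\mathbb R$ with $\int|x|^3\,dP<\infty$ and standard deviation $\sigma(P)>0$, let $\widetilde P$ be its standardization (its image under $x\mapsto (x-\mu(P))/\sigma(P)$, where $\mu(P)$ is the mean), and let $\varrho(P)=\int|x|^3\,d\widetilde P(x)$. For $\rho\ge 1$ put $$B(\rho)=\sqrt{\tfrac{\rho^2}{2}+\tfrac{\rho}{2}\sqrt{\rho^2+8}-2},\qquad A(\rho)=\frac{B(\rho)}{\rho},\qquad p_\rho=\tfrac12-\tfrac12\sqrt{\tfrac{\rho}{2}\sqrt{\rho^2+8}-\tfrac{\rho^2}{2}-1},\qquad q_\rho=1-p_\rho,$$ and let $P_\rho$ be the two-point law with mass $q_\rho$ at $-\sqrt{p_\rho/q_\rho}$ and mass $p_\rho$ at $\sqrt{q_\rho/p_\rho}$. A two-point law is a law charging exactly two distinct points. (1) Let $n\ge1$, let $P_1,\dots,P_n$ be probability laws on $\mathbb R$ with finite third absolute moments and positive standard deviations $\sigma_i=\sigma(P_i)$; put $\varrho_i=\varrho(P_i)$, $\sigma=(\sum_{i=1}^n\sigma_i^2)^{1/2}$, and let $\varphi$ be the characteristic function of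 the standardization of the convolution $P_1*\cdots*P_n$. Then for all $t\in\mathbb R$ $$\Bigl|\varphi(t)-\prod_{i=1}^n\cos\Bigl(\frac{\sigma_it}{\sigma}\Bigr)\Bigr|\le\frac{|t|^3}{6}\sum_{i=1}^n\frac{\sigma_i^3B(\varrho_i)}{\sigma^3},$$ $$\Bigl|\varphi(t)-1+\frac{t^2}{2}\Bigr|\le\frac{|t|^3}{6}\sum_{i=1}^n\frac{\sigma_i^3B(\varrho_i)}{\sigma^3}+\frac{t^4}{24}\sum_{i=1}^n\frac{\sigma_i^4}{\sigma^4}+\frac{t^4}{4}\sum_{i<j}\frac{\sigma_i^2\sigma_j^2}{\sigma^4}.$$ If all $P_i$ are two-point laws and their third centred moments are all $\ge0$ or all $\le0$, then the two sides of the first inequality are asymptotically equal as $t\to0$. (2) Let $X$ be a real random variable with $\mathbb EX=0$, $\mathbb EX^2=1$ and $\rho=\mathbb E|X|^3<\infty$. Then for all $t\in\mathbb R$ $$\Bigl|\mathbb E e^{itX}-1+\frac{t^2}{2}\Bigr|\le A(\rho)\frac{\rho|t|^3}{6}+\frac{t^4}{24}.$$ The law of $X$ is a two-point law if and only if $X\sim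 P_\rho$ or $-X\sim P_\rho$, and in this case the two sides of the inequality are asymptotically equal as $t\to0$. Here $f(t)$ and $g(t)$ are called asymptotically equal as $t\to0$ if $f(t)-g(t)=o(g(t))$. -/

import Mathlib

open MeasureTheory ProbabilityTheory Filter Topology Asymptotics

noncomputable section

namespace BerryEsseenSmooth

/-- The standard deviation `σ(P)` of a law `P` on the real line. -/
def sd (P : Measure ℝ) : ℝ := √(Var[id; P])

/-- The standardization `P̃` of a law `P`: its image under `x ↦ (x - μ(P)) / σ(P)`. -/
def standardization (P : Measure ℝ) : Measure ℝ :=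
  P.map fun x => (x - ∫ y, y ∂P) / sd P

/-- The standardized third absolute moment `ϱ(P) = ∫ |x|³ dP̃(x)`. -/
def stdAbsThird (P : Measure ℝ) : ℝ := ∫ x, |x| ^ 3 ∂(standardization P)

/-- The class of probability laws on the real line with finite third absolute moment and
strictly positive standard deviation. -/
def InP3 (P : Measure ℝ) : Prop :=
  IsProbabilityMeasure P ∧ Integrable (fun x : ℝ => |x| ^ 3) P ∧ 0 < sd P

/-- The convolution `P₁ * ⋯ * Pₙ`, i.e. the law of the sum of the coordinates under the
product law. -/
def convolution {n : ℕ} (P : Fin n → Measure ℝ) [∀ i, IsProbabilityMeasure (P i)] : Measure ℝ :=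
  (Measure.pi P).map fun x => ∑ i, x i

/-- The law `(1 - p) δ_a + p δ_b`. -/
def twoPoint (p a b : ℝ) : Measure ℝ :=
  ENNReal.ofReal (1 - p) • Measure.dirac a + ENNReal.ofReal p • Measure.dirac b

/-- `P` is a two-point law: it charges exactly two distinct points. -/
def IsTwoPoint (P : Measure ℝ) : Prop :=
  ∃ p a b : ℝ, 0 < p ∧ p < 1 ∧ a ≠ b ∧ P = twoPoint p a b

/-- `p_ρ = 1/2 - (1/2) √((ρ/2) √(ρ² + 8) - ρ²/2 - 1)`. -/
def pRho (ρ : ℝ) : ℝ := 1 / 2 - 1 / 2 * √(ρ / 2 * √(ρ ^ 2 + 8) - ρ ^ 2 / 2 - 1)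

/-- The two-point law `P_ρ` with mass `q = 1 - p_ρ` at `-√(p_ρ / q)` and mass `p_ρ` at
`√(q / p_ρ)`. -/
def PRho (ρ : ℝ) : Measure ℝ :=
  twoPoint (pRho ρ) (-√(pRho ρ / (1 - pRho ρ))) √((1 - pRho ρ) / pRho ρ)

/-- `B(ρ) = √(ρ²/2 + ρ √(ρ² + 8) / 2 - 2)`, for `ρ ≥ 1`. -/
def B (ρ : ℝ) : ℝ := √(ρ ^ 2 / 2 + ρ * √(ρ ^ 2 + 8) / 2 - 2)

/-- `A(ρ) = B(ρ) / ρ`, for `ρ ≥ 1`. -/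
def A (ρ : ℝ) : ℝ := ρ⁻¹ * B ρ

end BerryEsseenSmooth

end

/-! Everything reduces to comparing one standardized law `Q` with the Rademacher law, whose
characteristic function is the cosine. Both laws have the same moments up to order two, so Taylor's
formula around a point `c` writes the difference of their characteristic functions as the integral
of a function of modulus `|t|³` against the difference of the averaged Peano kernels. When that
difference has constant sign, its total mass gives the bound: `|t|³/6` times the difference of the
third absolute moments about `c` (`norm_charFun_sub_le_of_peanoKernel_le`).

The sign is secured by the choice of `c`. By Minkowski's inequality `u ↦ √(E (X-u)₊²)` is convex,
while for the Rademacher law it is affine on `[-1, 1]`. The two curves therefore cross in an orderly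
way at some `c` (`IsStandard.exists_sign_change`), and the kernels centred there are ordered.

It remains to show `E|X-c|³ ≤ 1 + 3c² + B(ρ)` (`third_moment_about_le`). This is integrated from a
pointwise majorant, a dual certificate (`exists_cubic_majorant`). Its core is the inequality `E X³ ≤
B(ρ)`, with equality for the law on `a` and `-1/a`, where `B(ρ) = a - 1/a`; the remaining tail of
`|X-c|³` is paid for by the truncated second moment, which is known at the crossing.

For sums, products of factors of modulus at most one are telescoped, and products of cosines are
expanded to fourth order. Asymptotic equality rests on `B(ρ) = |E X³|` for two-point laws: the `t³`
coefficients then agree, and third moments of one sign do not cancel. If they all vanish, the bounds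
force equality with the cosine product. -/

namespace BerryEsseenSmooth

/-! ### The function `B` and a pointwise cubic majorant -/

/-- Parametrization of `B` by two-point laws: the law with atoms `a` and `-1/a`. -/
lemma exists_atom_of_one_lt {ρ : ℝ} (hρ : 1 < ρ) :
    ∃ a : ℝ, 1 < a ∧ B ρ = a - a⁻¹ ∧ ρ = (a ^ 4 + 1) / (a * (a ^ 2 + 1)) := by
  set r := √(ρ ^ 2 + 8) with hr
  have hr2 : r ^ 2 = ρ ^ 2 + 8 := Real.sq_sqrt (by positivity)
  have hr3 : 3 < r := by
    rw [hr]; apply Real.lt_sqrt_of_sq_lt; nlinarith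
  have hpos : 0 < ρ ^ 2 / 2 + ρ * r / 2 - 2 := by nlinarith
  set b := B ρ with hb
  have hb' : b = √(ρ ^ 2 / 2 + ρ * r / 2 - 2) := rfl
  have hb2 : b ^ 2 = ρ ^ 2 / 2 + ρ * r / 2 - 2 := by rw [hb', Real.sq_sqrt hpos.le]
  have hb0 : 0 < b := by rw [hb']; exact Real.sqrt_pos.2 hpos
  set s := √(b ^ 2 + 4) with hs
  have hs2 : s ^ 2 = b ^ 2 + 4 := Real.sq_sqrt (by positivity)
  have hs0 : 2 < s := by
    rw [hs]; apply Real.lt_sqrt_of_sq_lt; nlinarith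
  -- Squared, this is the quadratic equation in `b²` whose positive root defines `B`. The atom `a`
  -- is then the positive root of `a² - b a - 1 = 0`.
  have hbs : ρ * s = b ^ 2 + 2 := by
    have h1 : (ρ * s) ^ 2 = (b ^ 2 + 2) ^ 2 := by
      rw [mul_pow, hs2, hb2]
      nlinarith [hr2]
    exact (sq_eq_sq₀ (by positivity) (by positivity)).1 h1
  have ha1 : 1 < (b + s) / 2 := by linarith
  have hinv : ((b + s) / 2)⁻¹ = (s - b) / 2 := by
    apply inv_eq_of_mul_eq_one_right
    nlinarith
  refine ⟨(b + s) / 2, ha1, by rw [hinv]; ring, ?_⟩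
  set a := (b + s) / 2 with ha
  have ha0 : 0 < a := by linarith
  have h2 : a * a = b * a + 1 := by rw [ha]; nlinarith
  have h3 : s * a = a ^ 2 + 1 := by rw [ha]; nlinarith
  rw [eq_div_iff (by positivity)]
  have h4 : b * a = a ^ 2 - 1 := by linarith
  have : ρ * (s * a) * a = (a ^ 4 + 1) := by
    calc ρ * (s * a) * a = (ρ * s) * a ^ 2 := by ring
      _ = (b * a) ^ 2 + 2 * a ^ 2 := by rw [hbs]; ring
      _ = _ := by rw [h4]; ring
  rw [h3] at this
  linarith

/-- The expression splits into terms with weights `1 - d`, `d (1 - d)` and `d²`, all visibly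
nonnegative except for a quadratic in `z` multiplying `d²`, which is handled by its discriminant.
This settles the majorant beyond its contact point `-1/a`, with `z = a y - 1`, `d = 1 - v` and `y =
-x`. -/
lemma cubic_tail_nonneg {a d z : ℝ} (ha : 1 < a) (hd : 0 ≤ d) (hd1 : d ≤ 1) (hz : 0 ≤ z) :
    0 ≤ 2 * a ^ 4 * z ^ 2 * ((a ^ 2 + 3) * z + 3 * (a ^ 2 + 1)) +
      ((a ^ 2 - 1) * (a ^ 4 + 4 * a ^ 2 + 1)) *
        (-(2 * z * (z + d) ^ 2) + a ^ 2 * (a - 1) * d ^ 2) := by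
  obtain ⟨t, ht, rfl⟩ : ∃ t, 0 < t ∧ a = 1 + t := ⟨a - 1, by linarith, by ring⟩
  set a := 1 + t with hat
  set D := (a ^ 2 - 1) * (a ^ 4 + 4 * a ^ 2 + 1) with hD
  have hD0 : 0 < D := by
    have : 0 < a ^ 2 - 1 := by nlinarith
    positivity
  set M := 6 * a ^ 4 * (a ^ 2 + 1) - 4 * D with hM
  have hM0 : 0 < M := by
    have h : M = 2 * a ^ 6 - 6 * a ^ 4 + 12 * a ^ 2 + 4 := by rw [hM, hD]; ring
    rw [h]; nlinarith [sq_nonneg (a ^ 3 - 2 * a), sq_nonneg (a ^ 2), sq_nonneg a]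
  -- The discriminant condition; after the substitution `a = 1 + t` all coefficients are positive.
  have hkey : D ≤ M * (a ^ 2 * (a - 1)) := by
    have : M * (a ^ 2 * (a - 1)) - D = (a - 1) *
        (2 * a ^ 8 - 6 * a ^ 6 - a ^ 5 + 11 * a ^ 4 - 4 * a ^ 3 - a - 1) := by
      rw [hM, hD]; ring
    have h2 : 0 ≤ 2 * a ^ 8 - 6 * a ^ 6 - a ^ 5 + 11 * a ^ 4 - 4 * a ^ 3 - a - 1 := by
      have : 2 * a ^ 8 - 6 * a ^ 6 - a ^ 5 + 11 * a ^ 4 - 4 * a ^ 3 - a - 1 =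
        6 * t ^ 1 + 10 * t ^ 2 + 22 * t ^ 3 + 56 * t ^ 4 + 75 * t ^ 5 + 50 * t ^ 6 + 16 * t ^ 7 + 2 * t ^ 8 := by
        rw [hat]; ring
      rw [this]; positivity
    have h3 : 0 ≤ a - 1 := by linarith
    linarith [mul_nonneg h3 h2]
  have hq : 0 ≤ M * z ^ 2 - 2 * D * z + D * (a ^ 2 * (a - 1)) := by
    have h1 : 0 ≤ M * (M * z ^ 2 - 2 * D * z + D * (a ^ 2 * (a - 1))) := by
      have h2 : M * (M * z ^ 2 - 2 * D * z + D * (a ^ 2 * (a - 1))) =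
        (M * z - D) ^ 2 + D * (M * (a ^ 2 * (a - 1)) - D) := by ring
      rw [h2]
      have := mul_nonneg hD0.le (sub_nonneg.2 hkey)
      positivity
    exact nonneg_of_mul_nonneg_right h1 hM0
  have hz2 : 0 ≤ z ^ 2 * (1 - d) * (6 * a ^ 4 * (a ^ 2 + 1)) := by
    have : 0 ≤ 1 - d := by linarith
    positivity
  have hz3 : 0 ≤ z ^ 3 * (2 * (3 * a ^ 2 + 1)) := by positivity
  have hd2 : 0 ≤ d * (1 - d) * (M * z ^ 2) := by
    have : 0 ≤ 1 - d := by linarith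
    positivity
  have e : 2 * a ^ 4 * z ^ 2 * ((a ^ 2 + 3) * z + 3 * (a ^ 2 + 1)) +
      D * (-(2 * z * (z + d) ^ 2) + a ^ 2 * (a - 1) * d ^ 2) =
      z ^ 3 * (2 * (3 * a ^ 2 + 1)) + z ^ 2 * (1 - d) * (6 * a ^ 4 * (a ^ 2 + 1)) +
      d * (1 - d) * (M * z ^ 2) +
      d ^ 2 * (M * z ^ 2 - 2 * D * z + D * (a ^ 2 * (a - 1))) := by
    rw [hM, hD]; ring
  rw [e]
  positivity

set_option maxHeartbeats 800000 in
/-- The quadratic majorant: with `D = (a²-1)(a⁴+4a²+1)`, the function `|x + v|³` is dominated by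
a combination of `|x|³`, a quadratic polynomial and the truncated square `(x + v)₋²`. -/
lemma exists_cubic_majorant {a v : ℝ} (ha : 1 < a) (hv0 : 0 ≤ v) (hv1 : v ≤ 1) :
    ∃ l α β γ θ : ℝ, 0 ≤ θ ∧
      l * ((a ^ 4 + 1) / (a * (a ^ 2 + 1))) + β + γ = a - a⁻¹ + 1 + 3 * v ^ 2 ∧
      ∀ x : ℝ, |x + v| ^ 3 ≤ l * |x| ^ 3 + β * x ^ 2 + α * x + γ +
        θ * (2 * (max (-v - x) 0) ^ 2 - (1 - v) ^ 2) := by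
  have ha0 : 0 < a := by linarith
  set D := (a ^ 2 - 1) * (a ^ 4 + 4 * a ^ 2 + 1) with hD
  have hD0 : 0 < D := by
    have : 0 < a ^ 2 - 1 := by nlinarith
    positivity
  have hv1' : 0 ≤ 1 - v := by linarith
  -- Apart from the terms in `v`, the coefficients are those for which `l|x|³ + βx² + αx + γ - x³`
  -- has double zeros at `a` and `-1/a`. The terms in `v` add `(x + v)³ - x³` and the slack `(1 -
  -- v)³`, where `3v + v³ + (1 - v)³ = 1 + 3v²`. The multiplier `θ` is the positive part of `-(x +
  -- v)` at the contact point `x = -1/a`.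
  refine ⟨(a ^ 2 + 1) ^ 3 / D, (6 * a ^ 4 - 6 * a ^ 2) / D + 3 * v ^ 2, -(12 * a ^ 3) / D + 3 * v,
    4 * a ^ 3 / D + v ^ 3 + (1 - v) ^ 3, max (1 / a - v) 0, le_max_right _ _, ?_, ?_⟩
  · have : a ^ 2 - 1 ≠ 0 := by nlinarith
    have : a ^ 4 + 4 * a ^ 2 + 1 ≠ 0 := by positivity
    rw [hD]
    field_simp
    ring
  intro x
  have hright : (a ^ 2 + 1) ^ 3 / D * x ^ 3 + (-(12 * a ^ 3) / D + 3 * v) * x ^ 2 +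
      ((6 * a ^ 4 - 6 * a ^ 2) / D + 3 * v ^ 2) * x + (4 * a ^ 3 / D + v ^ 3 + (1 - v) ^ 3)
      - (x + v) ^ 3 = 2 * (x - a) ^ 2 * ((3 * a ^ 2 + 1) * x + 2 * a) / D + (1 - v) ^ 3 := by
    field_simp
    rw [hD]; ring
  have hmid : (a ^ 2 + 1) ^ 3 / D * (-x) ^ 3 + (-(12 * a ^ 3) / D + 3 * v) * x ^ 2 +
      ((6 * a ^ 4 - 6 * a ^ 2) / D + 3 * v ^ 2) * x + (4 * a ^ 3 / D + v ^ 3 + (1 - v) ^ 3)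
      - (x + v) ^ 3 =
      2 * a ^ 2 * (a * x + 1) ^ 2 * ((a ^ 2 + 3) * (-x) + 2 * a) / D + (1 - v) ^ 3 := by
    field_simp
    rw [hD]; ring
  have ha1 : 1 / a < 1 := by rw [div_lt_one ha0]; exact ha
  set θ := max (1 / a - v) 0 with hθ
  have hθ0 : 0 ≤ θ := le_max_right _ _
  have hθ1 : θ ≤ 1 - v := max_le (by linarith) hv1'
  -- For `x ≥ -v` the truncated square vanishes, so the slack alone must absorb the cost of `θ`.
  have hθ2 : θ * (1 - v) ^ 2 ≤ (1 - v) ^ 3 := by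
    calc θ * (1 - v) ^ 2 ≤ (1 - v) * (1 - v) ^ 2 := by gcongr
      _ = _ := by ring
  rcases le_or_gt 0 x with hx | hx
  · have h1 : max (-v - x) 0 = 0 := max_eq_right (by linarith)
    have h2 : 0 ≤ 2 * (x - a) ^ 2 * ((3 * a ^ 2 + 1) * x + 2 * a) / D := by positivity
    have := hright
    rw [h1, abs_of_nonneg hx, abs_of_nonneg (by linarith : 0 ≤ x + v)]
    linarith
  rcases le_or_gt (-v) x with hxv | hxv
  · have h1 : max (-v - x) 0 = 0 := max_eq_right (by linarith)
    have h2 : 0 ≤ 2 * a ^ 2 * (a * x + 1) ^ 2 * ((a ^ 2 + 3) * (-x) + 2 * a) / D := by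
      have : 0 ≤ -x := by linarith
      positivity
    rw [h1, abs_of_neg hx, abs_of_nonneg (by linarith : 0 ≤ x + v)]
    linarith
  obtain ⟨y, rfl⟩ : ∃ y, x = -y := ⟨-x, by ring⟩
  have hyv : v < y := by linarith
  have h1 : max (-v - -y) 0 = y - v := by rw [max_eq_left (by linarith)]; ring
  rw [h1, abs_of_neg hx, abs_of_neg (by linarith : -y + v < 0)]
  have hD2 : D ≤ a ^ 4 * (a ^ 2 + 3) := by
    rw [hD]; linarith [sq_nonneg a, show (a ^ 2 - 1) * (a ^ 4 + 4 * a ^ 2 + 1) =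
      a ^ 4 * (a ^ 2 + 3) - 3 * a ^ 2 - 1 by ring]
  set Q := 2 * a ^ 2 * (a * -y + 1) ^ 2 * ((a ^ 2 + 3) * (- -y) + 2 * a) / D with hQ
  have hQ0 : 0 ≤ Q := by
    have : 0 ≤ - -y := by linarith
    positivity
  suffices h : 0 ≤ Q - 2 * (y - v) ^ 3 + (1 - v) ^ 3 + θ * (2 * (y - v) ^ 2 - (1 - v) ^ 2) by
    linarith [h, hmid]
  -- Left of `-v` the extra term `2 (y - v)³` must be absorbed. If `1/a ≤ v`, the double zero of `Q`
  -- has already been passed and `Q` alone suffices; otherwise `θ` turns that term into `2 (y - v)²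
  -- (y - 1/a)`, which is nonpositive up to the contact point.
  rcases le_total (1 / a) v with hav | hav
  · have hθe : θ = 0 := max_eq_right (by linarith)
    have h3 : 2 * (y - v) ^ 3 ≤ Q := by
      rw [hQ, le_div_iff₀ hD0]
      have hw : 0 < y - v := by linarith
      have h4 : a * (y - v) ≤ a * y - 1 := by
        rw [div_le_iff₀ ha0] at hav; linarith
      calc 2 * (y - v) ^ 3 * D ≤ 2 * (y - v) ^ 3 * (a ^ 4 * (a ^ 2 + 3)) := by gcongr
        _ = 2 * a ^ 2 * (a * (y - v)) ^ 2 * ((a ^ 2 + 3) * (y - v)) := by ring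
        _ ≤ 2 * a ^ 2 * (a * y - 1) ^ 2 * ((a ^ 2 + 3) * y + 2 * a) := by
          gcongr
          nlinarith [sq_nonneg a]
        _ = _ := by ring
    rw [hθe]
    have : 0 ≤ (1 - v) ^ 3 := by positivity
    linarith
  · have hθe : θ = 1 / a - v := max_eq_left (by linarith)
    have h5 : Q - 2 * (y - v) ^ 3 + (1 - v) ^ 3 + θ * (2 * (y - v) ^ 2 - (1 - v) ^ 2) =
        Q - 2 * (y - v) ^ 2 * (y - 1 / a) + (1 - v) ^ 2 * (1 - 1 / a) := by
      rw [hθe]; ring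
    rw [h5]
    have h6 : 0 ≤ (1 - v) ^ 2 * (1 - 1 / a) := by
      have : 0 ≤ 1 - 1 / a := by linarith
      positivity
    rcases le_total y (1 / a) with hya | hya
    · have : 0 ≤ (y - v) ^ 2 * (1 / a - y) := by
        have : 0 ≤ 1 / a - y := by linarith
        positivity
      linarith
    · have hz : 0 ≤ a * y - 1 := by
        rw [div_le_iff₀ ha0] at hya; linarith
      have h7 := cubic_tail_nonneg ha hv1' (by linarith) hz
      have h8 : (a * (y - v)) ^ 2 ≤ (a * y - 1 + (1 - v)) ^ 2 := by
        have : a * (y - v) ≤ a * y - 1 + (1 - v) := by nlinarith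
        have : 0 ≤ a * (y - v) := mul_nonneg ha0.le (by linarith)
        gcongr
      have h9 : a ^ 3 * D * (Q - 2 * (y - v) ^ 2 * (y - 1 / a) + (1 - v) ^ 2 * (1 - 1 / a)) =
          2 * a ^ 4 * (a * y - 1) ^ 2 * ((a ^ 2 + 3) * (a * y - 1) + 3 * (a ^ 2 + 1)) +
          D * (-(2 * (a * y - 1) * (a * (y - v)) ^ 2) + a ^ 2 * (a - 1) * (1 - v) ^ 2) := by
        rw [hQ]; field_simp; ring
      have h10 : D * (2 * (a * y - 1) * (a * (y - v)) ^ 2) ≤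
          D * (2 * (a * y - 1) * (a * y - 1 + (1 - v)) ^ 2) := by gcongr
      have h11 : 0 ≤ a ^ 3 * D *
          (Q - 2 * (y - v) ^ 2 * (y - 1 / a) + (1 - v) ^ 2 * (1 - 1 / a)) := by
        rw [h9]; rw [← hD] at h7; linarith
      exact nonneg_of_mul_nonneg_right h11 (by positivity)

/-! ### Moments of standardized laws -/

/-- A law with mean `0`, second moment `1` and finite third absolute moment. -/
structure IsStandard (Q : Measure ℝ) : Prop where
  integrable : Integrable (fun x : ℝ => |x| ^ 3) Q
  mean : ∫ x, x ∂Q = 0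
  second : ∫ x, x ^ 2 ∂Q = 1

lemma integrable_of_cubic_growth {Q : Measure ℝ} [IsFiniteMeasure Q] {E : Type*}
    [NormedAddCommGroup E] {f : ℝ → E} (hQ : Integrable (fun x : ℝ => |x| ^ 3) Q)
    (hf : AEStronglyMeasurable f Q) (C : ℝ) (h : ∀ x, ‖f x‖ ≤ C * (1 + |x| ^ 3)) :
    Integrable f Q :=
  Integrable.mono' (((integrable_const (1 : ℝ)).add hQ).const_mul C) hf (ae_of_all _ h)

lemma integrable_id_of_cube {Q : Measure ℝ} [IsFiniteMeasure Q]
    (hQ : Integrable (fun x : ℝ => |x| ^ 3) Q) : Integrable (fun x : ℝ => x) Q := by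
  refine integrable_of_cubic_growth hQ (by fun_prop) 1 fun x => ?_
  rw [Real.norm_eq_abs]
  nlinarith [abs_nonneg x, sq_nonneg (|x| - 1), mul_nonneg (abs_nonneg x) (sq_nonneg (|x| - 1))]

lemma integrable_sq_of_cube {Q : Measure ℝ} [IsFiniteMeasure Q]
    (hQ : Integrable (fun x : ℝ => |x| ^ 3) Q) : Integrable (fun x : ℝ => x ^ 2) Q := by
  refine integrable_of_cubic_growth hQ (by fun_prop) 1 fun x => ?_
  rw [Real.norm_eq_abs, abs_pow]
  nlinarith [abs_nonneg x, sq_nonneg (|x| - 1), mul_nonneg (abs_nonneg x) (sq_nonneg (|x| - 1))]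

lemma abs_add_cube_le (x c : ℝ) : |x + c| ^ 3 ≤ (4 + 4 * |c| ^ 3) * (1 + |x| ^ 3) := by
  have h : |x + c| ^ 3 ≤ (|x| + |c|) ^ 3 := by gcongr; exact abs_add_le x c
  have hx := abs_nonneg x
  have hc := abs_nonneg c
  have h2 : (|x| + |c|) ^ 3 ≤ 4 * (|x| ^ 3 + |c| ^ 3) := by
    nlinarith [mul_nonneg (add_nonneg hx hc) (sq_nonneg (|x| - |c|))]
  have h3 : 0 ≤ |x| ^ 3 * |c| ^ 3 := by positivity
  have h4 : 0 ≤ |x| ^ 3 := by positivity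
  have h5 : 0 ≤ |c| ^ 3 := by positivity
  nlinarith

lemma integrable_abs_add_cube {Q : Measure ℝ} [IsFiniteMeasure Q]
    (hQ : Integrable (fun x : ℝ => |x| ^ 3) Q) (c : ℝ) :
    Integrable (fun x : ℝ => |x + c| ^ 3) Q := by
  refine integrable_of_cubic_growth hQ (by fun_prop) (4 + 4 * |c| ^ 3) fun x => ?_
  rw [Real.norm_eq_abs, abs_of_nonneg (by positivity)]
  exact abs_add_cube_le x c

lemma integrable_max_sq {Q : Measure ℝ} [IsFiniteMeasure Q]
    (hQ : Integrable (fun x : ℝ => |x| ^ 3) Q) (c d : ℝ) :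
    Integrable (fun x : ℝ => (max (c * x + d) 0) ^ 2) Q := by
  have h : Integrable (fun x : ℝ => (c * x + d) ^ 2) Q := by
    have h1 := integrable_id_of_cube hQ
    have h2 := integrable_sq_of_cube hQ
    have := ((h2.const_mul (c ^ 2)).add (h1.const_mul (2 * c * d))).add
      (integrable_const (d ^ 2))
    refine this.congr (ae_of_all _ fun x => ?_)
    simp only [Pi.add_apply]; ring
  refine h.mono' (by fun_prop) (ae_of_all _ fun x => ?_)
  rw [Real.norm_eq_abs, abs_of_nonneg (by positivity)]
  rcases le_total (c * x + d) 0 with h0 | h0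
  · rw [max_eq_right h0, zero_pow two_ne_zero]; positivity
  · rw [max_eq_left h0]

lemma one_le_third_moment {Q : Measure ℝ} [IsProbabilityMeasure Q] (hQ : IsStandard Q) :
    1 ≤ ∫ x, |x| ^ 3 ∂Q := by
  have h2 := integrable_sq_of_cube hQ.integrable
  have h : ∫ x, (3 / 2 * x ^ 2 - 1 / 2) ∂Q ≤ ∫ x, |x| ^ 3 ∂Q := by
    refine integral_mono ((h2.const_mul _).sub (integrable_const _)) hQ.integrable fun x => ?_
    simp only
    rw [← sq_abs x]
    nlinarith [mul_nonneg (sq_nonneg (|x| - 1)) (by positivity : 0 ≤ 2 * |x| + 1)]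
  rw [integral_sub (h2.const_mul _) (integrable_const _), integral_const_mul, hQ.second] at h
  simp at h
  linarith

/-- Equality case of `2|x|³ - 3x² + 1 = (|x| - 1)² (2|x| + 1) ≥ 0`. The value `ρ = 1` needs separate
treatment because the majorant degenerates at `a = 1`. -/
lemma ae_abs_eq_one {Q : Measure ℝ} [IsProbabilityMeasure Q] (hQ : IsStandard Q)
    (h1 : ∫ x, |x| ^ 3 ∂Q = 1) : ∀ᵐ x ∂Q, |x| = 1 := by
  have h2 := integrable_sq_of_cube hQ.integrable
  have hnn : ∀ x : ℝ, 0 ≤ |x| ^ 3 - (3 / 2 * x ^ 2 - 1 / 2) := fun x => by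
    rw [← sq_abs x]
    nlinarith [mul_nonneg (sq_nonneg (|x| - 1)) (by positivity : 0 ≤ 2 * |x| + 1)]
  have hi : Integrable (fun x : ℝ => 3 / 2 * x ^ 2 - 1 / 2) Q :=
    (h2.const_mul _).sub (integrable_const _)
  have h0 : ∫ x, (|x| ^ 3 - (3 / 2 * x ^ 2 - 1 / 2)) ∂Q = 0 := by
    rw [integral_sub hQ.integrable hi, integral_sub (h2.const_mul _) (integrable_const _),
      integral_const_mul, hQ.second, h1]
    simp; norm_num
  rw [integral_eq_zero_iff_of_nonneg hnn (hQ.integrable.sub hi)] at h0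
  filter_upwards [h0] with x hx
  simp only [Pi.zero_apply] at hx
  rw [← sq_abs x] at hx
  have : (|x| - 1) ^ 2 * (2 * |x| + 1) = 0 := by linarith
  rcases mul_eq_zero.1 this with h | h
  · have := pow_eq_zero_iff (two_ne_zero) |>.1 h
    linarith
  · have := abs_nonneg x
    linarith

/-- The moment inequality behind the bound: at a sign change `-c v` of the kernel, the third
absolute moment about that point is controlled by `B`. -/
lemma third_moment_about_le {Q : Measure ℝ} [IsProbabilityMeasure Q] (hQ : IsStandard Q)
    (hρ : 1 < ∫ x, |x| ^ 3 ∂Q) {v c : ℝ} (hc : c = 1 ∨ c = -1) (hv0 : 0 ≤ v) (hv1 : v ≤ 1)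
    (hv : 2 * ∫ x, (max (-v - c * x) 0) ^ 2 ∂Q ≤ (1 - v) ^ 2) :
    ∫ x, |c * x + v| ^ 3 ∂Q ≤ 1 + 3 * v ^ 2 + B (∫ x, |x| ^ 3 ∂Q) := by
  obtain ⟨a, ha, hB, hρa⟩ := exists_atom_of_one_lt hρ
  obtain ⟨l, α, β, γ, θ, hθ, hsum, hmaj⟩ := exists_cubic_majorant ha hv0 hv1
  have hcabs : |c| = 1 := by rcases hc with rfl | rfl <;> simp
  have hc2 : c ^ 2 = 1 := by rcases hc with rfl | rfl <;> norm_num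
  have i1 := integrable_id_of_cube hQ.integrable
  have i2 := integrable_sq_of_cube hQ.integrable
  have i3 : Integrable (fun x : ℝ => (max (-v - c * x) 0) ^ 2) Q := by
    refine (integrable_max_sq hQ.integrable (-c) (-v)).congr (ae_of_all _ fun x => ?_)
    simp only; congr 2; ring
  have i4 : Integrable (fun x : ℝ => |c * x + v| ^ 3) Q := by
    refine (integrable_abs_add_cube hQ.integrable (c * v)).congr (ae_of_all _ fun x => ?_)
    simp only
    have : c * x + v = c * (x + c * v) := by linear_combination (-v) * hc2
    rw [this, abs_mul, hcabs, one_mul]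
  have e1 : ∫ x, |c * x + v| ^ 3 ∂Q ≤ ∫ x, (l * |x| ^ 3 + β * x ^ 2 + α * c * x + γ +
      θ * (2 * (max (-v - c * x) 0) ^ 2 - (1 - v) ^ 2)) ∂Q := by
    refine integral_mono i4 (((((hQ.integrable.const_mul l).add (i2.const_mul β)).add
      (i1.const_mul (α * c))).add (integrable_const γ)).add
      (((i3.const_mul 2).sub (integrable_const _)).const_mul θ)) fun x => ?_
    have := hmaj (c * x)
    rw [abs_mul, hcabs, one_mul, mul_pow, hc2, one_mul, ← mul_assoc] at this
    exact this
  rw [integral_add, integral_add, integral_add, integral_add, integral_const_mul,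
    integral_const_mul, integral_const_mul, integral_const_mul, integral_sub, integral_const_mul,
    hQ.mean, hQ.second] at e1
  · simp only [integral_const, probReal_univ, one_smul] at e1
    have h1 : θ * (2 * ∫ x, (max (-v - c * x) 0) ^ 2 ∂Q - (1 - v) ^ 2) ≤ 0 :=
      mul_nonpos_of_nonneg_of_nonpos hθ (by linarith)
    rw [← hρa] at hsum
    rw [hB]
    linarith
  · exact i3.const_mul 2
  · exact integrable_const _
  · exact hQ.integrable.const_mul l
  · exact i2.const_mul β
  · exact (hQ.integrable.const_mul l).add (i2.const_mul β)
  · exact i1.const_mul (α * c)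
  · exact ((hQ.integrable.const_mul l).add (i2.const_mul β)).add (i1.const_mul (α * c))
  · exact integrable_const _
  · exact (((hQ.integrable.const_mul l).add (i2.const_mul β)).add
      (i1.const_mul (α * c))).add (integrable_const γ)
  · exact ((i3.const_mul 2).sub (integrable_const _)).const_mul θ

/-! ### Peano kernels and Taylor remainders of characteristic functions -/

/-- The Peano kernel of the second order Taylor remainder at `c`, up to sign. -/
noncomputable def peanoKernel (c x u : ℝ) : ℝ :=
  if c < u then (max (x - u) 0) ^ 2 / 2 else (max (u - x) 0) ^ 2 / 2

lemma peanoKernel_nonneg (c x u : ℝ) : 0 ≤ peanoKernel c x u := by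
  unfold peanoKernel; split_ifs <;> positivity

lemma measurable_peanoKernel (c : ℝ) :
    Measurable (fun z : ℝ × ℝ => peanoKernel c z.1 z.2) := by
  unfold peanoKernel
  refine Measurable.ite (measurableSet_lt measurable_const measurable_snd) ?_ ?_ <;> fun_prop

lemma peanoKernel_of_le {c x : ℝ} (h : c ≤ x) (u : ℝ) :
    peanoKernel c x u = (Set.Ioc c x).indicator (fun u => (x - u) ^ 2 / 2) u := by
  unfold peanoKernel
  by_cases h1 : c < u
  · rw [if_pos h1]
    by_cases h2 : u ≤ x
    · rw [Set.indicator_of_mem (Set.mem_Ioc.2 ⟨h1, h2⟩), max_eq_left (by linarith)]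
    · rw [Set.indicator_of_notMem (fun h => h2 h.2), max_eq_right (by linarith)]; simp
  · rw [if_neg h1, Set.indicator_of_notMem (fun h => h1 h.1), max_eq_right (by linarith)]; simp

lemma peanoKernel_of_ge {c x : ℝ} (h : x ≤ c) (u : ℝ) :
    peanoKernel c x u = (Set.Ioc x c).indicator (fun u => (x - u) ^ 2 / 2) u := by
  unfold peanoKernel
  by_cases h1 : c < u
  · rw [if_pos h1, Set.indicator_of_notMem (fun h => absurd h.2 (by linarith)),
      max_eq_right (by linarith)]; simp
  · rw [if_neg h1]
    by_cases h2 : x < u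
    · rw [Set.indicator_of_mem (Set.mem_Ioc.2 ⟨h2, by linarith⟩), max_eq_left (by linarith)]
      ring
    · rw [Set.indicator_of_notMem (fun h => h2 h.1), max_eq_right (by linarith)]; simp

lemma integrable_peanoKernel (c x : ℝ) : Integrable (peanoKernel c x) := by
  have hcont : Continuous fun u : ℝ => (x - u) ^ 2 / 2 := by fun_prop
  rcases le_total c x with h | h
  · have : peanoKernel c x = (Set.Ioc c x).indicator (fun u => (x - u) ^ 2 / 2) :=
      funext (peanoKernel_of_le h)
    rw [this, integrable_indicator_iff measurableSet_Ioc]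
    exact hcont.integrableOn_Ioc
  · have : peanoKernel c x = (Set.Ioc x c).indicator (fun u => (x - u) ^ 2 / 2) :=
      funext (peanoKernel_of_ge h)
    rw [this, integrable_indicator_iff measurableSet_Ioc]
    exact hcont.integrableOn_Ioc

/-- The sign factor records the orientation of the interval from `c` to `x`. It does not depend on
`x`, so Fubini leaves a nonnegative averaged kernel. -/
lemma integral_peanoKernel_smul (c x : ℝ) (f : ℝ → ℂ) :
    ∫ u, (if c < u then 1 else -1 : ℂ) * f u * peanoKernel c x u =
      ∫ u in c..x, f u * ((x - u : ℝ) : ℂ) ^ 2 / 2 := by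
  rcases le_total c x with h | h
  · rw [intervalIntegral.integral_of_le h, ← integral_indicator measurableSet_Ioc]
    congr 1; ext u
    rw [peanoKernel_of_le h]
    by_cases hu : u ∈ Set.Ioc c x
    · rw [Set.indicator_of_mem hu, Set.indicator_of_mem hu, if_pos hu.1]
      push_cast; ring
    · rw [Set.indicator_of_notMem hu, Set.indicator_of_notMem hu]; simp
  · rw [intervalIntegral.integral_of_ge h, ← integral_indicator measurableSet_Ioc,
      ← integral_neg]
    congr 1; ext u
    rw [peanoKernel_of_ge h]
    by_cases hu : u ∈ Set.Ioc x c
    · rw [Set.indicator_of_mem hu, Set.indicator_of_mem hu, if_neg (not_lt.2 hu.2)]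
      push_cast; ring
    · rw [Set.indicator_of_notMem hu, Set.indicator_of_notMem hu]; simp

lemma integral_peanoKernel (c x : ℝ) : ∫ u, peanoKernel c x u = |x - c| ^ 3 / 6 := by
  have hF : ∀ u ∈ Set.univ, HasDerivAt (fun u : ℝ => -(x - u) ^ 3 / 6) ((x - u) ^ 2 / 2) u := by
    intro u _
    have h := ((((hasDerivAt_id u).const_sub x).pow 3).neg).div_const 6
    refine h.congr_deriv ?_
    simp; ring
  have hI : ∀ p q : ℝ, ∫ u in p..q, (x - u) ^ 2 / 2 = (x - p) ^ 3 / 6 - (x - q) ^ 3 / 6 := by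
    intro p q
    rw [intervalIntegral.integral_eq_sub_of_hasDerivAt (fun u _ => hF u trivial)
      (by apply Continuous.intervalIntegrable; fun_prop)]
    ring
  rcases le_total c x with h | h
  · simp_rw [peanoKernel_of_le h]
    rw [integral_indicator measurableSet_Ioc, ← intervalIntegral.integral_of_le h, hI,
      abs_of_nonneg (by linarith)]
    ring
  · simp_rw [peanoKernel_of_ge h]
    rw [integral_indicator measurableSet_Ioc, ← intervalIntegral.integral_of_le h, hI,
      abs_of_nonpos (by linarith)]
    ring

/-- Second order Taylor polynomial at `c` of `x ↦ exp (i t x)`. -/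
noncomputable def expTaylor (t c x : ℝ) : ℂ :=
  Complex.exp (t * c * Complex.I) *
    (1 + t * Complex.I * (x - c) + (t * Complex.I) ^ 2 * (x - c) ^ 2 / 2)

lemma exp_eq_expTaylor_add (t c x : ℝ) :
    Complex.exp (t * x * Complex.I) = expTaylor t c x +
      ∫ u, (if c < u then 1 else -1 : ℂ) *
        ((t * Complex.I) ^ 3 * Complex.exp (t * u * Complex.I)) * peanoKernel c x u := by
  rw [integral_peanoKernel_smul]
  -- Differentiating the Taylor polynomial at `x` in its base point `u` cancels everything but the
  -- third order term.
  have hG : ∀ u : ℝ, HasDerivAt (fun u : ℝ => Complex.exp (t * u * Complex.I) *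
      (1 + t * Complex.I * ((x : ℂ) - u) + (t * Complex.I) ^ 2 * ((x : ℂ) - u) ^ 2 / 2))
      (((t * Complex.I) ^ 3 * Complex.exp (t * u * Complex.I)) * ((x - u : ℝ) : ℂ) ^ 2 / 2) u := by
    intro u
    have h0 : HasDerivAt (fun u : ℝ => (u : ℂ)) 1 u := Complex.ofRealCLM.hasDerivAt
    have h1 : HasDerivAt (fun u : ℝ => Complex.exp (t * u * Complex.I))
        (Complex.exp (t * u * Complex.I) * (t * 1 * Complex.I)) u :=
      ((h0.const_mul (t : ℂ)).mul_const Complex.I).cexp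
    have h2 : HasDerivAt (fun u : ℝ => (x : ℂ) - u) (-1) u := h0.const_sub _
    have h3 := h1.mul (((h2.const_mul (t * Complex.I)).const_add 1).add
      (((h2.pow 2).const_mul ((t * Complex.I) ^ 2)).div_const 2))
    refine (h3.congr_deriv ?_).congr_of_eventuallyEq (Eventually.of_forall fun y => ?_)
    · simp only [Pi.add_apply, Pi.pow_apply]; push_cast; ring
    · simp [mul_div_assoc, mul_assoc]
  rw [intervalIntegral.integral_eq_sub_of_hasDerivAt (fun u _ => hG u)
    (by apply Continuous.intervalIntegrable; fun_prop)]
  simp [expTaylor]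

lemma integrable_mul_peanoKernel_prod {Q : Measure ℝ} [IsProbabilityMeasure Q]
    (hQ : Integrable (fun x : ℝ => |x| ^ 3) Q) (c : ℝ) {h : ℝ → ℂ} (hm : Measurable h)
    {C : ℝ} (hC : ∀ u, ‖h u‖ ≤ C) :
    Integrable (fun z : ℝ × ℝ => h z.2 * (peanoKernel c z.1 z.2 : ℂ)) (Q.prod volume) := by
  have hk : Integrable (fun z : ℝ × ℝ => peanoKernel c z.1 z.2) (Q.prod volume) := by
    rw [integrable_prod_iff (measurable_peanoKernel c).aestronglyMeasurable]
    refine ⟨ae_of_all _ fun x => integrable_peanoKernel c x, ?_⟩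
    simp only [Real.norm_eq_abs, abs_of_nonneg (peanoKernel_nonneg _ _ _), integral_peanoKernel]
    exact (integrable_abs_add_cube hQ (-c)).div_const 6
  exact hk.ofReal.bdd_mul (hm.comp measurable_snd).aestronglyMeasurable
    (ae_of_all _ fun z => hC z.2)

lemma integrable_expTaylor {Q : Measure ℝ} [IsProbabilityMeasure Q]
    (hQ : Integrable (fun x : ℝ => |x| ^ 3) Q) (t c : ℝ) : Integrable (expTaylor t c) Q := by
  have i1 : Integrable (fun x : ℝ => (x : ℂ)) Q := (integrable_id_of_cube hQ).ofReal
  have i2 : Integrable (fun x : ℝ => ((x ^ 2 : ℝ) : ℂ)) Q := (integrable_sq_of_cube hQ).ofReal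
  set e := Complex.exp (t * c * Complex.I) with he
  have := (((integrable_const (e * (1 - t * Complex.I * c + (t * Complex.I) ^ 2 * c ^ 2 / 2))).add
    (i1.const_mul (e * (t * Complex.I - (t * Complex.I) ^ 2 * c)))).add
    (i2.const_mul (e * ((t * Complex.I) ^ 2 / 2))))
  refine this.congr (ae_of_all _ fun x => ?_)
  simp only [Pi.add_apply, expTaylor]
  rw [← he]
  push_cast
  ring

lemma integral_expTaylor {Q : Measure ℝ} [IsProbabilityMeasure Q]
    (hQ : Integrable (fun x : ℝ => |x| ^ 3) Q) (t c : ℝ) :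
    ∫ x, expTaylor t c x ∂Q = Complex.exp (t * c * Complex.I) *
      ((1 - t * Complex.I * c + (t * Complex.I) ^ 2 * c ^ 2 / 2) +
        (t * Complex.I - (t * Complex.I) ^ 2 * c) * ((∫ x, x ∂Q : ℝ) : ℂ) +
        (t * Complex.I) ^ 2 / 2 * ((∫ x, x ^ 2 ∂Q : ℝ) : ℂ)) := by
  have i1 : Integrable (fun x : ℝ => (x : ℂ)) Q := (integrable_id_of_cube hQ).ofReal
  have i2 : Integrable (fun x : ℝ => ((x ^ 2 : ℝ) : ℂ)) Q := (integrable_sq_of_cube hQ).ofReal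
  have : ∀ x : ℝ, expTaylor t c x = Complex.exp (t * c * Complex.I) *
      ((1 - t * Complex.I * c + (t * Complex.I) ^ 2 * c ^ 2 / 2) +
        (t * Complex.I - (t * Complex.I) ^ 2 * c) * (x : ℂ) +
        (t * Complex.I) ^ 2 / 2 * ((x ^ 2 : ℝ) : ℂ)) := fun x => by
    simp only [expTaylor]; push_cast; ring
  have i3 : Integrable (fun x : ℝ => (1 - t * Complex.I * c + (t * Complex.I) ^ 2 * c ^ 2 / 2) +
      (t * Complex.I - (t * Complex.I) ^ 2 * c) * (x : ℂ)) Q :=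
    (integrable_const _).add (i1.const_mul _)
  simp_rw [this]
  rw [integral_const_mul, integral_add i3 (i2.const_mul _), integral_add (integrable_const _) (i1.const_mul _), integral_const_mul,
    integral_const_mul, integral_complex_ofReal, integral_complex_ofReal, integral_const,
    probReal_univ, one_smul]

lemma charFun_eq_peano {Q : Measure ℝ} [IsProbabilityMeasure Q]
    (hQ : Integrable (fun x : ℝ => |x| ^ 3) Q) (t c : ℝ) :
    charFun Q t = ∫ x, expTaylor t c x ∂Q +
      ∫ u, ((if c < u then 1 else -1 : ℂ) *
        ((t * Complex.I) ^ 3 * Complex.exp (t * u * Complex.I))) *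
          ((∫ x, peanoKernel c x u ∂Q : ℝ) : ℂ) := by
  set h : ℝ → ℂ := fun u => (if c < u then 1 else -1 : ℂ) *
        ((t * Complex.I) ^ 3 * Complex.exp (t * u * Complex.I)) with hh
  have hm : Measurable h := by
    refine Measurable.mul (Measurable.ite measurableSet_Ioi measurable_const measurable_const) ?_
    fun_prop
  have hC : ∀ u, ‖h u‖ ≤ |t| ^ 3 := by
    intro u
    have e1 : ‖Complex.exp (t * u * Complex.I)‖ = 1 := by
      have := Complex.norm_exp_ofReal_mul_I (t * u)
      push_cast at this; exact this
    simp only [hh, norm_mul, norm_pow, e1, Complex.norm_real, Complex.norm_I, Real.norm_eq_abs]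
    split_ifs <;> simp
  have hp := integrable_mul_peanoKernel_prod hQ c hm hC
  rw [charFun_apply_real]
  rw [integral_congr_ae (ae_of_all _ fun x => exp_eq_expTaylor_add t c x)]
  rw [integral_add (integrable_expTaylor hQ t c) hp.integral_prod_left]
  congr 1
  rw [integral_integral_swap hp]
  congr 1; ext u
  simp only
  rw [integral_const_mul, integral_complex_ofReal]

lemma integral_integral_peanoKernel {Q : Measure ℝ} [IsProbabilityMeasure Q]
    (hQ : Integrable (fun x : ℝ => |x| ^ 3) Q) (c : ℝ) :
    Integrable (fun u => ∫ x, peanoKernel c x u ∂Q) ∧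
    ∫ u, ∫ x, peanoKernel c x u ∂Q = (∫ x, |x - c| ^ 3 ∂Q) / 6 := by
  have hk : Integrable (fun z : ℝ × ℝ => peanoKernel c z.1 z.2) (Q.prod volume) := by
    have := (integrable_mul_peanoKernel_prod hQ c (h := fun _ => 1) measurable_const
      (C := 1) (by simp)).re
    simpa using this
  refine ⟨hk.integral_prod_right, ?_⟩
  rw [← integral_integral_swap hk]
  simp_rw [integral_peanoKernel]
  rw [integral_div]

/-- If the kernels of two laws with the same first two moments are ordered, their characteristic
functions are compared by the third absolute moments about `c`. -/
theorem norm_charFun_sub_le_of_peanoKernel_le {P Q : Measure ℝ} [IsProbabilityMeasure P]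
    [IsProbabilityMeasure Q] (hP : Integrable (fun x : ℝ => |x| ^ 3) P)
    (hQ : Integrable (fun x : ℝ => |x| ^ 3) Q) (h1 : ∫ x, x ∂P = ∫ x, x ∂Q)
    (h2 : ∫ x, x ^ 2 ∂P = ∫ x, x ^ 2 ∂Q) (c : ℝ)
    (hk : ∀ u, ∫ x, peanoKernel c x u ∂Q ≤ ∫ x, peanoKernel c x u ∂P) (t : ℝ) :
    ‖charFun P t - charFun Q t‖ ≤
      |t| ^ 3 / 6 * (∫ x, |x - c| ^ 3 ∂P - ∫ x, |x - c| ^ 3 ∂Q) := by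
  obtain ⟨iP, eP⟩ := integral_integral_peanoKernel hP c
  obtain ⟨iQ, eQ⟩ := integral_integral_peanoKernel hQ c
  set h : ℝ → ℂ := fun u => (if c < u then 1 else -1 : ℂ) *
        ((t * Complex.I) ^ 3 * Complex.exp (t * u * Complex.I)) with hh
  have hm : Measurable h := by
    refine Measurable.mul (Measurable.ite measurableSet_Ioi measurable_const measurable_const) ?_
    fun_prop
  have hC : ∀ u, ‖h u‖ = |t| ^ 3 := by
    intro u
    have e1 : ‖Complex.exp (t * u * Complex.I)‖ = 1 := by
      have := Complex.norm_exp_ofReal_mul_I (t * u)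
      push_cast at this; exact this
    simp only [hh, norm_mul, norm_pow, e1, Complex.norm_real, Complex.norm_I, Real.norm_eq_abs]
    split_ifs <;> simp
  have jP : Integrable (fun u => h u * ((∫ x, peanoKernel c x u ∂P : ℝ) : ℂ)) :=
    iP.ofReal.bdd_mul hm.aestronglyMeasurable (ae_of_all _ fun u => (hC u).le)
  have jQ : Integrable (fun u => h u * ((∫ x, peanoKernel c x u ∂Q : ℝ) : ℂ)) :=
    iQ.ofReal.bdd_mul hm.aestronglyMeasurable (ae_of_all _ fun u => (hC u).le)
  rw [charFun_eq_peano hP t c, charFun_eq_peano hQ t c, integral_expTaylor hP,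
    integral_expTaylor hQ, h1, h2, add_sub_add_left_eq_sub, ← integral_sub jP jQ]
  calc _ ≤ ∫ u, |t| ^ 3 * (∫ x, peanoKernel c x u ∂P - ∫ x, peanoKernel c x u ∂Q) := by
        refine norm_integral_le_of_norm_le ((iP.sub iQ).const_mul _) (ae_of_all _ fun u => ?_)
        rw [← mul_sub, norm_mul, hC, ← Complex.ofReal_sub, Complex.norm_real, Real.norm_eq_abs,
          abs_of_nonneg (sub_nonneg.2 (hk u))]
    _ = _ := by
        rw [integral_const_mul, integral_sub iP iQ, eP, eQ]; ring

/-! ### Two-point laws and the Rademacher law -/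

lemma isProbabilityMeasure_twoPoint {p : ℝ} (h0 : 0 ≤ p) (h1 : p ≤ 1) (a b : ℝ) :
    IsProbabilityMeasure (twoPoint p a b) := by
  constructor
  simp only [twoPoint, Measure.coe_add, Measure.coe_smul, Pi.add_apply, Pi.smul_apply,
    measure_univ, smul_eq_mul, mul_one]
  rw [← ENNReal.ofReal_add (by linarith) h0]
  simp

lemma integrable_twoPoint (p a b : ℝ) {E : Type*} [NormedAddCommGroup E] (f : ℝ → E) :
    Integrable f (twoPoint p a b) := by
  unfold twoPoint
  exact ((integrable_dirac (by simp)).smul_measure ENNReal.ofReal_ne_top).add_measure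
    ((integrable_dirac (by simp)).smul_measure ENNReal.ofReal_ne_top)

lemma integral_twoPoint {p : ℝ} (h0 : 0 ≤ p) (h1 : p ≤ 1) (a b : ℝ) {E : Type*}
    [NormedAddCommGroup E] [NormedSpace ℝ E] [CompleteSpace E] (f : ℝ → E) :
    ∫ x, f x ∂(twoPoint p a b) = (1 - p) • f a + p • f b := by
  unfold twoPoint
  rw [integral_add_measure
    ((integrable_dirac (by simp)).smul_measure ENNReal.ofReal_ne_top)
    ((integrable_dirac (by simp)).smul_measure ENNReal.ofReal_ne_top),
    integral_smul_measure, integral_smul_measure, integral_dirac, integral_dirac,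
    ENNReal.toReal_ofReal (by linarith), ENNReal.toReal_ofReal h0]

/-- The symmetric two-point law on `{-1, 1}`. -/
noncomputable def rademacher : Measure ℝ := twoPoint (1 / 2) (-1) 1

instance : IsProbabilityMeasure rademacher :=
  isProbabilityMeasure_twoPoint (by norm_num) (by norm_num) _ _

lemma integral_rademacher {E : Type*} [NormedAddCommGroup E] [NormedSpace ℝ E] [CompleteSpace E]
    (f : ℝ → E) : ∫ x, f x ∂rademacher = (1 / 2 : ℝ) • f (-1) + (1 / 2 : ℝ) • f 1 := by
  rw [rademacher, integral_twoPoint (by norm_num) (by norm_num)]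
  norm_num

lemma charFun_rademacher (t : ℝ) : charFun rademacher t = ((Real.cos t : ℝ) : ℂ) := by
  rw [charFun_apply_real, integral_rademacher, Complex.ofReal_cos, Complex.cos]
  simp only [Complex.real_smul]
  push_cast
  ring_nf

/-! ### The single sign change and the comparison with the cosine -/

lemma max_convex {u w x α β : ℝ} (hα : 0 ≤ α) (hβ : 0 ≤ β) (hαβ : α + β = 1)
    (hu : u = α * (-1) + β * w) :
    max (x - u) 0 ≤ α * max (x + 1) 0 + β * max (x - w) 0 := by
  have h1 := mul_le_mul_of_nonneg_left (le_max_left (x + 1) 0) hα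
  have h2 := mul_le_mul_of_nonneg_left (le_max_left (x - w) 0) hβ
  refine max_le ?_ (by positivity)
  have : x - u = α * (x + 1) + β * (x - w) := by
    rw [hu]; linear_combination (-x) * hαβ
  linarith

/-- Second moment of the positive part of `X - u`. -/
noncomputable def upperSq (Q : Measure ℝ) (u : ℝ) : ℝ := ∫ x, (max (x - u) 0) ^ 2 ∂Q

section signChange

variable {Q : Measure ℝ} [IsProbabilityMeasure Q]

lemma IsStandard.integrable_upper (hQ : IsStandard Q) (u : ℝ) :
    Integrable (fun x : ℝ => (max (x - u) 0) ^ 2) Q := by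
  refine (integrable_max_sq hQ.integrable 1 (-u)).congr (ae_of_all _ fun x => ?_)
  simp only; congr 2; ring

lemma IsStandard.integral_shift_sq (hQ : IsStandard Q) (u : ℝ) :
    Integrable (fun x : ℝ => (x - u) ^ 2) Q ∧ ∫ x, (x - u) ^ 2 ∂Q = 1 + u ^ 2 := by
  have i1 := integrable_id_of_cube hQ.integrable
  have i2 := integrable_sq_of_cube hQ.integrable
  have e : (fun x : ℝ => (x - u) ^ 2) = fun x => x ^ 2 - 2 * u * x + u ^ 2 := by
    ext x; ring
  have i3 : Integrable (fun x : ℝ => x ^ 2 - 2 * u * x) Q := i2.sub (i1.const_mul _)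
  rw [e]
  refine ⟨i3.add (integrable_const _), ?_⟩
  rw [integral_add i3 (integrable_const _), integral_sub i2 (i1.const_mul _), integral_const_mul,
    hQ.mean, hQ.second]
  simp

/-- The two truncated squares add up to `(x - u)²`, so `upperSq` controls both branches of the
kernel, and ordering the lower branch reverses the inequality. -/
lemma IsStandard.lower_sq (hQ : IsStandard Q) (u : ℝ) :
    ∫ x, (max (u - x) 0) ^ 2 ∂Q = 1 + u ^ 2 - upperSq Q u := by
  obtain ⟨i, e⟩ := hQ.integral_shift_sq u
  rw [← e, upperSq, ← integral_sub i (hQ.integrable_upper u)]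
  congr 1; ext x
  rcases le_total x u with h | h
  · rw [max_eq_left (by linarith), max_eq_right (by linarith)]; ring
  · rw [max_eq_right (by linarith), max_eq_left (by linarith)]; ring

lemma upperSq_nonneg (Q : Measure ℝ) (u : ℝ) : 0 ≤ upperSq Q u :=
  integral_nonneg fun _ => by positivity

lemma IsStandard.upperSq_le (hQ : IsStandard Q) (u : ℝ) : upperSq Q u ≤ 1 + u ^ 2 := by
  have := hQ.lower_sq u
  have h : 0 ≤ ∫ x, (max (u - x) 0) ^ 2 ∂Q := integral_nonneg fun _ => by positivity
  linarith

lemma IsStandard.continuousOn_upperSq (hQ : IsStandard Q) :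
    ContinuousOn (upperSq Q) (Set.Icc (-1) 1) := by
  have hb := (hQ.integral_shift_sq 1).1.add (hQ.integral_shift_sq (-1)).1
  refine continuousOn_of_dominated (bound := fun x => (x - 1) ^ 2 + (x - (-1)) ^ 2)
    (fun u _ => by fun_prop) (fun u hu => ae_of_all _ fun x => ?_) hb
    (ae_of_all _ fun x => by fun_prop)
  rw [Real.norm_eq_abs, abs_of_nonneg (by positivity)]
  obtain ⟨h1, h2⟩ := hu
  rcases le_total (x - u) 0 with h | h
  · rw [max_eq_right h, zero_pow two_ne_zero]; positivity
  · rw [max_eq_left h]; nlinarith [sq_nonneg (x - 1)]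

/-- On `[-1, 1]` the set where `upperSq Q u ≤ (1 - u)² / 2` is a lower set. -/
lemma IsStandard.upperSq_le_of_le (hQ : IsStandard Q) {u w : ℝ} (hu : -1 ≤ u) (huw : u < w)
    (hw : w ≤ 1) (h : upperSq Q w ≤ (1 - w) ^ 2 / 2) : upperSq Q u ≤ (1 - u) ^ 2 / 2 := by
  -- This is Minkowski's inequality between the endpoints `-1` and `w`, written as a weighted
  -- Cauchy–Schwarz inequality. The weights should be the endpoint values `2` and `1 - w`; adding
  -- `δ` avoids a division by zero at `w = 1`.
  refine le_of_forall_pos_le_add fun δ hδ => ?_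
  have hw1 : 0 < w + 1 := by linarith
  set α := (w - u) / (w + 1) with hα
  set β := (u + 1) / (w + 1) with hβ
  have hα0 : 0 ≤ α := div_nonneg (by linarith) hw1.le
  have hβ0 : 0 ≤ β := div_nonneg (by linarith) hw1.le
  have hβ1 : β ≤ 1 := by rw [hβ, div_le_one hw1]; linarith
  have hαβ : α + β = 1 := by rw [hα, hβ]; field_simp; ring
  have hue : u = α * (-1) + β * w := by rw [hα, hβ]; field_simp; ring
  set L := 1 - w + δ with hL
  have hL0 : 0 < L := by linarith
  have hpt : ∀ x : ℝ, (max (x - u) 0) ^ 2 ≤ (2 * α + β * L) * (α / 2) * (max (x - (-1)) 0) ^ 2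
      + (2 * α + β * L) * (β / L) * (max (x - w) 0) ^ 2 := by
    intro x
    have h1 := max_convex (x := x) hα0 hβ0 hαβ hue
    have h2 : (max (x - u) 0) ^ 2 ≤ (α * max (x + 1) 0 + β * max (x - w) 0) ^ 2 := by
      have : 0 ≤ max (x - u) 0 := le_max_right _ _
      gcongr
    refine h2.trans ?_
    rw [sub_neg_eq_add]
    set p := max (x + 1) 0
    set q := max (x - w) 0
    have : (2 * α + β * L) * (α / 2) * p ^ 2 + (2 * α + β * L) * (β / L) * q ^ 2 -
        (α * p + β * q) ^ 2 = α * β / (2 * L) * (L * p - 2 * q) ^ 2 := by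
      field_simp; ring
    have h3 : 0 ≤ α * β / (2 * L) * (L * p - 2 * q) ^ 2 := by positivity
    linarith
  have hint : upperSq Q u ≤ (2 * α + β * L) * (α / 2) * upperSq Q (-1)
      + (2 * α + β * L) * (β / L) * upperSq Q w := by
    unfold upperSq
    rw [← integral_const_mul, ← integral_const_mul,
      ← integral_add ((hQ.integrable_upper _).const_mul _) ((hQ.integrable_upper _).const_mul _)]
    exact integral_mono (hQ.integrable_upper u)
      (((hQ.integrable_upper _).const_mul _).add ((hQ.integrable_upper _).const_mul _)) hpt
  have hm1 : upperSq Q (-1) ≤ 2 := by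
    have := hQ.upperSq_le (-1); norm_num at this; exact this
  have h2α : 2 * α + β * (1 - w) = 1 - u := by rw [hue]; linear_combination hαβ
  have hw2 : (β / L) * upperSq Q w ≤ β * (1 - w) / 2 := by
    calc (β / L) * upperSq Q w ≤ (β / L) * ((1 - w) ^ 2 / 2) := by gcongr
      _ = β * (1 - w) / 2 * ((1 - w) / L) := by ring
      _ ≤ β * (1 - w) / 2 * 1 := by
        have : 0 ≤ 1 - w := by linarith
        gcongr
        rw [div_le_one hL0]; linarith
      _ = _ := mul_one _
  have hc : 0 ≤ 2 * α + β * L := by positivity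
  calc upperSq Q u ≤ (2 * α + β * L) * ((α / 2) * upperSq Q (-1) + (β / L) * upperSq Q w) := by
        linarith
    _ ≤ (2 * α + β * L) * ((α / 2) * 2 + β * (1 - w) / 2) := by gcongr
    _ = (1 - u + β * δ) * ((1 - u) / 2) := by
        rw [← h2α, hL]; ring
    _ ≤ (1 - u) ^ 2 / 2 + δ := by
        have : 0 ≤ 1 - u := by linarith
        have h3 : β * δ * ((1 - u) / 2) ≤ 1 * δ * 1 := by
          gcongr; linarith
        linarith

/-- The kernel difference against the Rademacher law has a single change of sign. -/
lemma IsStandard.exists_sign_change (hQ : IsStandard Q) : ∃ c ∈ Set.Icc (-1 : ℝ) 1,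
    upperSq Q c = (1 - c) ^ 2 / 2 ∧
    (∀ u, -1 ≤ u → u ≤ c → upperSq Q u ≤ (1 - u) ^ 2 / 2) ∧
    (∀ u, c ≤ u → u ≤ 1 → (1 - u) ^ 2 / 2 ≤ upperSq Q u) := by
  have hcont : ContinuousOn (fun u => upperSq Q u - (1 - u) ^ 2 / 2) (Set.Icc (-1) 1) :=
    hQ.continuousOn_upperSq.sub (by fun_prop)
  have hm1 : upperSq Q (-1) - (1 - (-1)) ^ 2 / 2 ≤ 0 := by
    have := hQ.upperSq_le (-1); norm_num at this ⊢; linarith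
  have h1 : 0 ≤ upperSq Q 1 - (1 - 1) ^ 2 / 2 := by
    have := upperSq_nonneg Q 1; norm_num; exact this
  set Z := Set.Icc (-1 : ℝ) 1 ∩ (fun u => upperSq Q u - (1 - u) ^ 2 / 2) ⁻¹' {0} with hZ
  have hZc : IsCompact Z :=
    isCompact_Icc.of_isClosed_subset
      (hcont.preimage_isClosed_of_isClosed isClosed_Icc isClosed_singleton) Set.inter_subset_left
  have hZn : Z.Nonempty := by
    obtain ⟨c, hc, hc0⟩ := intermediate_value_Icc (by norm_num) hcont ⟨hm1, h1⟩
    exact ⟨c, hc, hc0⟩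
  -- The greatest zero is taken: a negative value to its right would force another zero, since the
  -- difference is nonnegative at `1`.
  obtain ⟨c, ⟨hcI, hc0⟩, hcmax⟩ := hZc.exists_isGreatest hZn
  have hc0' : upperSq Q c = (1 - c) ^ 2 / 2 := by
    have : upperSq Q c - (1 - c) ^ 2 / 2 = 0 := hc0
    linarith
  refine ⟨c, hcI, hc0', fun u hu huc => ?_, fun u hcu hu => ?_⟩
  · rcases huc.eq_or_lt with rfl | h
    · exact hc0'.le
    · exact hQ.upperSq_le_of_le hu h hcI.2 hc0'.le
  · by_contra! hlt
    obtain ⟨d, hd, hd0⟩ := intermediate_value_Icc hu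
      (hcont.mono (Set.Icc_subset_Icc (hcI.1.trans hcu) le_rfl)) ⟨by linarith, h1⟩
    have hdc : d ≤ c := hcmax ⟨⟨hcI.1.trans (hcu.trans hd.1), hd.2⟩, hd0⟩
    have : u = c := le_antisymm (hd.1.trans hdc) hcu
    rw [this, hc0'] at hlt
    exact lt_irrefl _ hlt

lemma upperSq_rademacher (u : ℝ) :
    upperSq rademacher u = ((max (-1 - u) 0) ^ 2 + (max (1 - u) 0) ^ 2) / 2 := by
  rw [upperSq, integral_rademacher]; simp; ring

lemma isStandard_rademacher : IsStandard rademacher where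
  integrable := integrable_twoPoint _ _ _ _
  mean := by rw [integral_rademacher]; simp
  second := by rw [integral_rademacher]; norm_num

lemma IsStandard.integral_peanoKernel (hQ : IsStandard Q) (c u : ℝ) :
    ∫ x, peanoKernel c x u ∂Q =
      if c < u then upperSq Q u / 2 else (1 + u ^ 2 - upperSq Q u) / 2 := by
  unfold peanoKernel
  split_ifs
  · rw [integral_div, upperSq]
  · rw [integral_div, hQ.lower_sq]

lemma integral_abs_sub_cube_rademacher {c : ℝ} (hc : c ∈ Set.Icc (-1 : ℝ) 1) :
    ∫ x, |x - c| ^ 3 ∂rademacher = 1 + 3 * c ^ 2 := by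
  rw [integral_rademacher, abs_of_nonpos (by linarith [hc.1]), abs_of_nonneg (by linarith [hc.2])]
  simp only [smul_eq_mul]; ring

/-- Sharp third order comparison of a standardized characteristic function with the cosine. -/
theorem IsStandard.norm_charFun_sub_cos_le (hQ : IsStandard Q) (t : ℝ) :
    ‖charFun Q t - ((Real.cos t : ℝ) : ℂ)‖ ≤ |t| ^ 3 / 6 * B (∫ x, |x| ^ 3 ∂Q) := by
  rcases (one_le_third_moment hQ).eq_or_lt with h1 | h1
  · have hae := ae_abs_eq_one hQ h1.symm
    have : charFun Q t = ((Real.cos t : ℝ) : ℂ) := by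
      -- On `{-1, 1}` the exponential is affine in `x`, so mean zero alone yields the cosine.
      have e : ∀ᵐ x : ℝ ∂Q, Complex.exp (t * x * Complex.I) =
          (Real.cos t : ℂ) + (Real.sin t : ℂ) * Complex.I * (x : ℂ) := by
        filter_upwards [hae] with x hx
        rcases (abs_eq (by norm_num)).1 hx with rfl | rfl
        · rw [Complex.exp_mul_I]; push_cast; ring_nf
        · rw [Complex.exp_mul_I]; push_cast
          rw [show (t : ℂ) * -1 = -t by ring, Complex.cos_neg, Complex.sin_neg]; ring
      have i1 : Integrable (fun x : ℝ => (x : ℂ)) Q := (integrable_id_of_cube hQ.integrable).ofReal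
      have hm : ∫ x, (x : ℂ) ∂Q = 0 := by
        rw [integral_complex_ofReal, hQ.mean, Complex.ofReal_zero]
      rw [charFun_apply_real, integral_congr_ae e,
        integral_add (integrable_const _) (i1.const_mul _), integral_const_mul, hm]
      simp
    rw [this, sub_self, norm_zero]
    have : 0 ≤ B (∫ x, |x| ^ 3 ∂Q) := Real.sqrt_nonneg _
    positivity
  obtain ⟨c, hcI, hc, hlow, hup⟩ := hQ.exists_sign_change
  have hk : ∀ u, ∫ x, peanoKernel c x u ∂rademacher ≤ ∫ x, peanoKernel c x u ∂Q := by
    intro u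
    rw [hQ.integral_peanoKernel, isStandard_rademacher.integral_peanoKernel, upperSq_rademacher]
    split_ifs with hcu
    · rw [max_eq_right (by linarith [hcI.1] : -1 - u ≤ 0)]
      rcases le_total u 1 with hu | hu
      · rw [max_eq_left (by linarith)]
        linarith [hup u hcu.le hu]
      · rw [max_eq_right (by linarith)]
        linarith [upperSq_nonneg Q u]
    · have hcu : u ≤ c := not_lt.1 hcu
      rw [max_eq_left (by linarith [hcI.2] : 0 ≤ 1 - u)]
      rcases le_total (-1) u with hu | hu
      · rw [max_eq_right (by linarith)]
        linarith [hlow u hu hcu]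
      · rw [max_eq_left (by linarith)]
        linarith [hQ.upperSq_le u]
  have hmain := norm_charFun_sub_le_of_peanoKernel_le hQ.integrable
    isStandard_rademacher.integrable (hQ.mean.trans isStandard_rademacher.mean.symm)
    (hQ.second.trans isStandard_rademacher.second.symm) c hk t
  rw [charFun_rademacher, integral_abs_sub_cube_rademacher hcI] at hmain
  refine hmain.trans ?_
  have hmom : ∫ x, |x - c| ^ 3 ∂Q ≤ 1 + 3 * c ^ 2 + B (∫ x, |x| ^ 3 ∂Q) := by
    -- The moment bound needs `v = |c|`; for `c ≥ 0` it is applied to the reflected law. The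
    -- crossing equation gives its truncated-square hypothesis, with equality, in both cases.
    rcases le_total c 0 with h0 | h0
    · have := third_moment_about_le hQ h1 (v := -c) (c := 1) (Or.inl rfl) (by linarith)
        (by linarith [hcI.1]) ?_
      · simpa [sub_eq_add_neg] using this
      · have := hQ.lower_sq c
        simp only [neg_neg, one_mul]
        rw [this, hc]; linarith
    · have := third_moment_about_le hQ h1 (v := c) (c := -1) (Or.inr rfl) h0 hcI.2 ?_
      · convert this using 3 with x
        rw [← abs_neg]; congr 2; ring
      · have : ∀ x : ℝ, -c - -1 * x = x - c := fun x => by ring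
        simp_rw [this]
        rw [← upperSq, hc]; linarith
  have : 0 ≤ |t| ^ 3 / 6 := by positivity
  apply mul_le_mul_of_nonneg_left _ this
  linarith

end signChange

/-! ### Standardized two-point laws as the extremal case -/

lemma twoPoint_comm (p a b : ℝ) : twoPoint p a b = twoPoint (1 - p) b a := by
  rw [twoPoint, twoPoint, add_comm, sub_sub_cancel]

lemma map_twoPoint (p a b : ℝ) {f : ℝ → ℝ} (hf : Measurable f) :
    (twoPoint p a b).map f = twoPoint p (f a) (f b) := by
  rw [twoPoint, Measure.map_add _ _ hf, Measure.map_smul, Measure.map_smul,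
    Measure.map_dirac' hf, Measure.map_dirac' hf, twoPoint]

lemma IsTwoPoint.map {P : Measure ℝ} (hP : IsTwoPoint P) {f : ℝ → ℝ} (hf : Measurable f)
    (hinj : Function.Injective f) : IsTwoPoint (P.map f) := by
  obtain ⟨p, a, b, h0, h1, hab, rfl⟩ := hP
  exact ⟨p, f a, f b, h0, h1, hinj.ne hab, map_twoPoint p a b hf⟩

/-- The standardized two-point law with mass `p` at its positive atom. -/
noncomputable def stdTwoPoint (p : ℝ) : Measure ℝ :=
  twoPoint p (-√(p / (1 - p))) √((1 - p) / p)

lemma sqrt_div_eq {p q : ℝ} (hp : 0 < p) (hq : 0 < q) : √(p / q) = p / √(p * q) := by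
  have hg : 0 < √(p * q) := Real.sqrt_pos.2 (by positivity)
  have hg2 : √(p * q) ^ 2 = p * q := Real.sq_sqrt (by positivity)
  rw [Real.sqrt_eq_iff_mul_self_eq (by positivity) (by positivity), div_mul_div_comm,
    ← pow_two (√(p * q)), hg2]
  field_simp

lemma stdTwoPoint_eq {p : ℝ} (h0 : 0 < p) (h1 : p < 1) :
    stdTwoPoint p = twoPoint p (-(p / √(p * (1 - p)))) ((1 - p) / √(p * (1 - p))) := by
  rw [stdTwoPoint, sqrt_div_eq h0 (by linarith), sqrt_div_eq (by linarith) h0, mul_comm (1 - p) p]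

lemma isTwoPoint_stdTwoPoint {p : ℝ} (h0 : 0 < p) (h1 : p < 1) : IsTwoPoint (stdTwoPoint p) := by
  have h1' : 0 < 1 - p := by linarith
  have hb : 0 < √((1 - p) / p) := Real.sqrt_pos.2 (by positivity)
  have ha : 0 ≤ √(p / (1 - p)) := Real.sqrt_nonneg _
  exact ⟨p, _, _, h0, h1, by linarith, rfl⟩

lemma map_neg_stdTwoPoint (p : ℝ) :
    (stdTwoPoint p).map (fun x => -x) = stdTwoPoint (1 - p) := by
  rw [stdTwoPoint, map_twoPoint _ _ _ measurable_neg, twoPoint_comm, stdTwoPoint, neg_neg,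
    sub_sub_cancel]

/-- A two-point law with mean `0` and second moment `1` is some `stdTwoPoint p`. -/
lemma IsTwoPoint.exists_eq_stdTwoPoint {Q : Measure ℝ} (hQ : IsTwoPoint Q)
    (hm : ∫ x, x ∂Q = 0) (hs : ∫ x, x ^ 2 ∂Q = 1) :
    ∃ p, 0 < p ∧ p < 1 ∧ Q = stdTwoPoint p := by
  have key : ∀ p a b : ℝ, 0 < p → p < 1 → a < b → Q = twoPoint p a b → Q = stdTwoPoint p := by
    intro p a b h0 h1 hab hQe
    rw [hQe, integral_twoPoint h0.le h1.le] at hm hs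
    simp only [smul_eq_mul] at hm hs
    have hq : 0 < 1 - p := by linarith
    have hb2 : b ^ 2 = (1 - p) / p := by
      rw [eq_div_iff h0.ne']
      have : (1 - p) * ((1 - p) * a ^ 2 + p * b ^ 2) = 1 - p := by rw [hs]; ring
      linear_combination this - ((1 - p) * a - p * b) * hm
    have ha2 : (-a) ^ 2 = p / (1 - p) := by
      rw [eq_div_iff hq.ne']
      have : p * ((1 - p) * a ^ 2 + p * b ^ 2) = p := by rw [hs]; ring
      linear_combination this - (p * b - (1 - p) * a) * hm
    have hb0 : 0 ≤ b := by
      by_contra! hneg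
      nlinarith [mul_pos hq (by linarith : 0 < -a), mul_pos h0 (by linarith : 0 < -b)]
    have ha0 : 0 ≤ -a := by
      by_contra! hneg
      nlinarith [mul_pos hq (by linarith : 0 < a), mul_pos h0 (by linarith : 0 < b)]
    rw [hQe, stdTwoPoint, ← hb2, ← ha2, Real.sqrt_sq hb0, Real.sqrt_sq ha0, neg_neg]
  obtain ⟨p, a, b, h0, h1, hab, hQe⟩ := hQ
  rcases hab.lt_or_gt with h | h
  · exact ⟨p, h0, h1, key p a b h0 h1 h hQe⟩
  · exact ⟨1 - p, by linarith, by linarith, key (1 - p) b a (by linarith) (by linarith) h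
      (by rw [hQe, twoPoint_comm])⟩

section moments

variable {p : ℝ}

lemma integral_cube_stdTwoPoint (h0 : 0 < p) (h1 : p < 1) :
    ∫ x, x ^ 3 ∂(stdTwoPoint p) = (1 - 2 * p) / √(p * (1 - p)) := by
  have hq : 0 < 1 - p := by linarith
  have hg : 0 < √(p * (1 - p)) := Real.sqrt_pos.2 (by positivity)
  have hg2 : √(p * (1 - p)) ^ 2 = p * (1 - p) := Real.sq_sqrt (by positivity)
  rw [stdTwoPoint_eq h0 h1, integral_twoPoint h0.le h1.le]
  set g := √(p * (1 - p))
  simp only [smul_eq_mul]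
  field_simp
  rw [hg2]; ring

lemma integral_abs_cube_stdTwoPoint (h0 : 0 < p) (h1 : p < 1) :
    ∫ x, |x| ^ 3 ∂(stdTwoPoint p) = (1 - 2 * (p * (1 - p))) / √(p * (1 - p)) := by
  have hq : 0 < 1 - p := by linarith
  have hg : 0 < √(p * (1 - p)) := Real.sqrt_pos.2 (by positivity)
  have hg2 : √(p * (1 - p)) ^ 2 = p * (1 - p) := Real.sq_sqrt (by positivity)
  rw [stdTwoPoint_eq h0 h1, integral_twoPoint h0.le h1.le, abs_neg, abs_of_nonneg (by positivity),
    abs_of_nonneg (by positivity)]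
  set g := √(p * (1 - p))
  simp only [smul_eq_mul]
  field_simp
  rw [hg2]; ring

/-- With `g = √(p (1 - p))` one has `ρ = 1/g - 2g`, hence `ρ² + 8 = (1/g + 2g)²`. The nested roots
in `B` and `pRho` therefore resolve for two-point laws. -/
lemma third_moment_mul_sqrt (h0 : 0 < p) (h1 : p < 1) {ρ : ℝ}
    (hρ : ρ = (1 - 2 * (p * (1 - p))) / √(p * (1 - p))) :
    ρ * √(ρ ^ 2 + 8) = 1 / (p * (1 - p)) - 4 * (p * (1 - p)) ∧
      ρ ^ 2 = 1 / (p * (1 - p)) - 4 + 4 * (p * (1 - p)) := by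
  have hq : 0 < 1 - p := by linarith
  have hg : 0 < √(p * (1 - p)) := Real.sqrt_pos.2 (by positivity)
  have hg2 : √(p * (1 - p)) ^ 2 = p * (1 - p) := Real.sq_sqrt (by positivity)
  set g := √(p * (1 - p))
  rw [← hg2] at hρ ⊢
  have hs : √(ρ ^ 2 + 8) = (1 + 2 * g ^ 2) / g := by
    rw [Real.sqrt_eq_iff_mul_self_eq (by positivity) (by positivity), hρ]
    field_simp; ring
  rw [hs, hρ]
  constructor
  · field_simp; ring
  · field_simp; ring

lemma B_stdTwoPoint (h0 : 0 < p) (h1 : p < 1) :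
    B (∫ x, |x| ^ 3 ∂(stdTwoPoint p)) = |∫ x, x ^ 3 ∂(stdTwoPoint p)| := by
  have hq : 0 < 1 - p := by linarith
  have hg2 : √(p * (1 - p)) ^ 2 = p * (1 - p) := Real.sq_sqrt (by positivity)
  obtain ⟨e1, e2⟩ := third_moment_mul_sqrt h0 h1 (integral_abs_cube_stdTwoPoint h0 h1)
  rw [B, e1, e2, integral_cube_stdTwoPoint h0 h1, ← Real.sqrt_sq_eq_abs, div_pow, hg2]
  congr 1
  field_simp; ring

lemma pRho_stdTwoPoint (h0 : 0 < p) (h1 : p < 1) :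
    pRho (∫ x, |x| ^ 3 ∂(stdTwoPoint p)) = 1 / 2 - 1 / 2 * |1 - 2 * p| := by
  obtain ⟨e1, e2⟩ := third_moment_mul_sqrt h0 h1 (integral_abs_cube_stdTwoPoint h0 h1)
  rw [pRho, div_mul_eq_mul_div (∫ x, |x| ^ 3 ∂(stdTwoPoint p)) 2, e1, e2, ← Real.sqrt_sq_eq_abs]
  congr 3; ring

lemma stdTwoPoint_eq_PRho (h0 : 0 < p) (h1 : p < 1) :
    stdTwoPoint p = PRho (∫ x, |x| ^ 3 ∂(stdTwoPoint p)) ∨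
      (stdTwoPoint p).map (fun x => -x) = PRho (∫ x, |x| ^ 3 ∂(stdTwoPoint p)) := by
  have hP : ∀ r, PRho r = stdTwoPoint (pRho r) := fun _ => rfl
  rw [map_neg_stdTwoPoint, hP, pRho_stdTwoPoint h0 h1]
  rcases le_total (2 * p) 1 with h | h
  · left
    rw [abs_of_nonneg (by linarith)]; congr 1; ring
  · right
    rw [abs_of_nonpos (by linarith)]; congr 1; ring

end moments

/-- Since `ρ² (ρ² + 8) = (ρ² + 4)² - 16`, the radicand in `pRho` stays below `1` for every real `ρ`,
and `PRho ρ` never degenerates. -/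
lemma pRho_pos (ρ : ℝ) : 0 < pRho ρ := by
  have hr2 : √(ρ ^ 2 + 8) ^ 2 = ρ ^ 2 + 8 := Real.sq_sqrt (by positivity)
  have : √(ρ / 2 * √(ρ ^ 2 + 8) - ρ ^ 2 / 2 - 1) < 1 := by
    rw [Real.sqrt_lt' one_pos]
    have h : ρ * √(ρ ^ 2 + 8) < ρ ^ 2 + 4 := by
      apply lt_of_pow_lt_pow_left₀ 2 (by positivity)
      rw [mul_pow, hr2]; nlinarith
    linarith
  rw [pRho]; linarith

lemma pRho_lt_one (ρ : ℝ) : pRho ρ < 1 := by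
  have : 0 ≤ √(ρ / 2 * √(ρ ^ 2 + 8) - ρ ^ 2 / 2 - 1) := Real.sqrt_nonneg _
  rw [pRho]; linarith

lemma isTwoPoint_PRho (ρ : ℝ) : IsTwoPoint (PRho ρ) :=
  isTwoPoint_stdTwoPoint (pRho_pos ρ) (pRho_lt_one ρ)

/-- A standardized law is a two-point law iff it is `P_ρ` or the reflection of `P_ρ`. -/
lemma isTwoPoint_iff_PRho {Q : Measure ℝ} (hm : ∫ x, x ∂Q = 0) (hs : ∫ x, x ^ 2 ∂Q = 1) :
    IsTwoPoint Q ↔ (Q = PRho (∫ x, |x| ^ 3 ∂Q) ∨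
      Q.map (fun x => -x) = PRho (∫ x, |x| ^ 3 ∂Q)) := by
  constructor
  · intro h
    obtain ⟨p, h0, h1, rfl⟩ := h.exists_eq_stdTwoPoint hm hs
    exact stdTwoPoint_eq_PRho h0 h1
  · rintro (h | h)
    · rw [h]; exact isTwoPoint_PRho _
    · have h2 := (isTwoPoint_PRho (∫ x, |x| ^ 3 ∂Q)).map measurable_neg neg_injective
      rw [← h, Measure.map_map measurable_neg measurable_neg] at h2
      simpa [Function.comp_def, Measure.map_id'] using h2

lemma IsTwoPoint.B_eq {Q : Measure ℝ} (hQ : IsTwoPoint Q) (hm : ∫ x, x ∂Q = 0)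
    (hs : ∫ x, x ^ 2 ∂Q = 1) : B (∫ x, |x| ^ 3 ∂Q) = |∫ x, x ^ 3 ∂Q| := by
  obtain ⟨p, h0, h1, rfl⟩ := hQ.exists_eq_stdTwoPoint hm hs
  exact B_stdTwoPoint h0 h1

/-! ### Expansions at zero, products of cosines, comparison of products -/

lemma isBigO_exp_sub_sum (x : ℝ) (n : ℕ) :
    (fun t : ℝ => Complex.exp (t * x * Complex.I) -
      ∑ m ∈ Finset.range n, (t * x * Complex.I) ^ m / m.factorial) =O[𝓝 0] fun t => t ^ n := by
  refine IsBigO.of_bound (|x| ^ n * Real.exp |x|) ?_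
  have : Set.Icc (-1 : ℝ) 1 ∈ 𝓝 (0 : ℝ) := Icc_mem_nhds (by norm_num) (by norm_num)
  filter_upwards [this] with t ht
  have hn : ‖(t * x * Complex.I : ℂ)‖ = |t| * |x| := by simp
  have ht' : |t| ≤ 1 := abs_le.2 ht
  refine (Complex.norm_exp_sub_sum_le_norm_mul_exp _ n).trans ?_
  rw [hn, mul_pow, norm_pow, Real.norm_eq_abs]
  calc |t| ^ n * |x| ^ n * Real.exp (|t| * |x|) ≤ |t| ^ n * |x| ^ n * Real.exp (1 * |x|) := by
        gcongr
    _ = _ := by rw [one_mul]; ring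

/-- Taylor expansion of the characteristic function of a two-point law. -/
lemma IsTwoPoint.isBigO_charFun {Q : Measure ℝ} (hQ : IsTwoPoint Q) (n : ℕ) :
    (fun t : ℝ => charFun Q t - ∑ m ∈ Finset.range n,
      (t * Complex.I) ^ m / m.factorial * ((∫ x, x ^ m ∂Q : ℝ) : ℂ)) =O[𝓝 0] fun t => t ^ n := by
  obtain ⟨p, a, b, h0, h1, -, rfl⟩ := hQ
  have h := ((isBigO_exp_sub_sum a n).const_mul_left ((1 - p : ℝ) : ℂ)).add
    ((isBigO_exp_sub_sum b n).const_mul_left (p : ℂ))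
  refine h.congr_left fun t => ?_
  rw [charFun_apply_real, integral_twoPoint h0.le h1.le]
  simp only [integral_twoPoint h0.le h1.le, Complex.real_smul, smul_eq_mul]
  rw [mul_sub, mul_sub, Finset.mul_sum, Finset.mul_sum, sub_add_sub_comm,
    ← Finset.sum_add_distrib]
  congr 1
  refine Finset.sum_congr rfl fun m _ => ?_
  push_cast
  ring

lemma isTwoPoint_rademacher : IsTwoPoint rademacher :=
  ⟨1 / 2, -1, 1, by norm_num, by norm_num, by norm_num, rfl⟩

/-- The half-angle formula turns `sin y ≥ y - y³/6` at `y = |x|/2` into the fourth order upper bound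
for the cosine. -/
lemma abs_cos_sub_one_add_sq_le (x : ℝ) : |Real.cos x - 1 + x ^ 2 / 2| ≤ x ^ 4 / 24 := by
  have h1 := Real.one_sub_sq_div_two_le_cos (x := x)
  rw [abs_of_nonneg (by linarith)]
  have key : ∀ y : ℝ, 0 ≤ y → y ^ 2 - y ^ 4 / 3 ≤ Real.sin y ^ 2 := by
    intro y hy
    have h2 := Real.sin_ge_sub_cube hy
    rcases le_total (y ^ 2) 6 with h | h
    · have h3 : 0 ≤ y - y ^ 3 / 6 := by nlinarith
      have h4 : (y - y ^ 3 / 6) ^ 2 ≤ Real.sin y ^ 2 := by gcongr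
      have h5 : 0 ≤ y ^ 6 := by positivity
      linarith [show (y - y ^ 3 / 6) ^ 2 = y ^ 2 - y ^ 4 / 3 + y ^ 6 / 36 by ring]
    · nlinarith [sq_nonneg (Real.sin y), sq_nonneg y]
  have h2 := key (|x| / 2) (by positivity)
  have h3 : Real.cos x = 1 - 2 * Real.sin (|x| / 2) ^ 2 := by
    rw [← Real.cos_abs x]
    have := Real.cos_sq_add_sin_sq (|x| / 2)
    have h4 := Real.cos_two_mul (|x| / 2)
    rw [mul_div_cancel₀ _ (two_ne_zero)] at h4
    linarith
  have h5 : |x| ^ 4 = x ^ 4 := Even.pow_abs (by decide) x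
  have h6 : |x| ^ 2 = x ^ 2 := sq_abs x
  rw [div_pow, div_pow, h5, h6] at h2
  linarith

/-- Induction on the number of factors. Each new cosine creates the cross term `(Pr - 1) (cos x₀ -
1)`, whose factors are bounded by half of the corresponding sums of squares; this is the origin of
`1/4`. -/
lemma abs_prod_cos_sub_one_add_le {n : ℕ} (x : Fin n → ℝ) :
    |∏ i, Real.cos (x i) - 1 + (∑ i, x i ^ 2) / 2| ≤ 1 / 24 * ∑ i, x i ^ 4 +
      1 / 4 * ∑ i, ∑ j ∈ Finset.Ioi i, x i ^ 2 * x j ^ 2 := by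
  induction n with
  | zero => simp
  | succ n ih =>
    rw [Fin.prod_univ_succ, Fin.sum_univ_succ, Fin.sum_univ_succ, Fin.sum_univ_succ]
    have hI : ∀ i : Fin n, ∑ j ∈ Finset.Ioi i.succ, x i.succ ^ 2 * x j ^ 2 =
        ∑ j ∈ Finset.Ioi i, x i.succ ^ 2 * x j.succ ^ 2 := fun i => by
      rw [Fin.sum_Ioi_succ]
    have h0 : ∑ j ∈ Finset.Ioi (0 : Fin (n + 1)), x 0 ^ 2 * x j ^ 2 =
        x 0 ^ 2 * ∑ j : Fin n, x j.succ ^ 2 := by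
      rw [Fin.sum_Ioi_zero, Finset.mul_sum]
    simp_rw [hI]
    rw [h0]
    have hih := ih (fun i => x i.succ)
    set Pr := ∏ i : Fin n, Real.cos (x i.succ)
    set S := ∑ i : Fin n, x i.succ ^ 2 with hS
    have hc := abs_cos_sub_one_add_sq_le (x 0)
    have hS0 : 0 ≤ S := Finset.sum_nonneg fun _ _ => by positivity
    have hPr : |Pr - 1| ≤ S / 2 := by
      have h : ∀ s : Finset (Fin n), |∏ i ∈ s, Real.cos (x i.succ) - 1| ≤
          (∑ i ∈ s, x i.succ ^ 2) / 2 := by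
        intro s
        induction s using Finset.induction_on with
        | empty => simp
        | insert a s ha ihs =>
          rw [Finset.prod_insert ha, Finset.sum_insert ha]
          have e : Real.cos (x a.succ) * ∏ i ∈ s, Real.cos (x i.succ) - 1 =
            Real.cos (x a.succ) * (∏ i ∈ s, Real.cos (x i.succ) - 1) +
              (Real.cos (x a.succ) - 1) := by ring
          have h1 := Real.one_sub_sq_div_two_le_cos (x := x a.succ)
          have h2 := Real.cos_le_one (x a.succ)
          rw [e]
          calc _ ≤ |Real.cos (x a.succ)| * |∏ i ∈ s, Real.cos (x i.succ) - 1| +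
                |Real.cos (x a.succ) - 1| := by
                rw [← abs_mul]; exact abs_add_le _ _
            _ ≤ 1 * ((∑ i ∈ s, x i.succ ^ 2) / 2) + x a.succ ^ 2 / 2 := by
                gcongr
                · exact Real.abs_cos_le_one _
                · rw [abs_of_nonpos (by linarith)]; linarith
            _ = _ := by ring
      exact h Finset.univ
    have hc1 : |Real.cos (x 0) - 1| ≤ x 0 ^ 2 / 2 := by
      have h1 := Real.one_sub_sq_div_two_le_cos (x := x 0)
      have h2 := Real.cos_le_one (x 0)
      rw [abs_of_nonpos (by linarith)]; linarith
    have e : Real.cos (x 0) * Pr - 1 + (x 0 ^ 2 + S) / 2 =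
        (Pr - 1 + S / 2) + (Real.cos (x 0) - 1 + x 0 ^ 2 / 2) + (Pr - 1) * (Real.cos (x 0) - 1) := by
      ring
    rw [e]
    calc _ ≤ |Pr - 1 + S / 2| + |Real.cos (x 0) - 1 + x 0 ^ 2 / 2| +
          |Pr - 1| * |Real.cos (x 0) - 1| := by
          rw [← abs_mul]; exact abs_add_three _ _ _
      _ ≤ (1 / 24 * ∑ i : Fin n, x i.succ ^ 4 +
          1 / 4 * ∑ i : Fin n, ∑ j ∈ Finset.Ioi i, x i.succ ^ 2 * x j.succ ^ 2) + x 0 ^ 4 / 24 +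
          S / 2 * (x 0 ^ 2 / 2) := by gcongr
      _ = _ := by ring

lemma norm_prod_sub_prod_le {ι : Type*} (s : Finset ι) (f g : ι → ℂ) (hf : ∀ i, ‖f i‖ ≤ 1)
    (hg : ∀ i, ‖g i‖ ≤ 1) : ‖∏ i ∈ s, f i - ∏ i ∈ s, g i‖ ≤ ∑ i ∈ s, ‖f i - g i‖ := by
  classical
  induction s using Finset.induction_on with
  | empty => simp
  | insert a s ha ih =>
    rw [Finset.prod_insert ha, Finset.prod_insert ha, Finset.sum_insert ha]
    have e : f a * ∏ i ∈ s, f i - g a * ∏ i ∈ s, g i =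
      (f a - g a) * ∏ i ∈ s, f i + g a * (∏ i ∈ s, f i - ∏ i ∈ s, g i) := by ring
    have hp : ‖∏ i ∈ s, f i‖ ≤ 1 := by
      rw [norm_prod]
      exact Finset.prod_le_one (fun _ _ => norm_nonneg _) fun i _ => hf i
    rw [e]
    calc _ ≤ ‖f a - g a‖ * ‖∏ i ∈ s, f i‖ + ‖g a‖ * ‖∏ i ∈ s, f i - ∏ i ∈ s, g i‖ := by
          rw [← norm_mul, ← norm_mul]; exact norm_add_le _ _
      _ ≤ ‖f a - g a‖ * 1 + 1 * ∑ i ∈ s, ‖f i - g i‖ := by gcongr; exact hg a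
      _ = _ := by ring

/-- First order expansion of the difference of two products with factors tending to `1`. -/
lemma isLittleO_prod_sub_prod {ι : Type*} (s : Finset ι) (f g : ι → ℝ → ℂ) (d : ι → ℂ) (k : ℕ)
    (hf : ∀ i, Tendsto (f i) (𝓝 0) (𝓝 1)) (hg : ∀ i, Tendsto (g i) (𝓝 0) (𝓝 1))
    (h : ∀ i, (fun t : ℝ => f i t - g i t - d i * (t : ℂ) ^ k) =o[𝓝 0] fun t : ℝ => t ^ k) :
    (fun t : ℝ => ∏ i ∈ s, f i t - ∏ i ∈ s, g i t - (∑ i ∈ s, d i) * (t : ℂ) ^ k) =o[𝓝 0]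
      fun t : ℝ => t ^ k := by
  classical
  induction s using Finset.induction_on with
  | empty => simp
  | insert a s ha ih =>
    have hprod : Tendsto (fun t => ∏ i ∈ s, f i t) (𝓝 0) (𝓝 1) := by
      simpa using tendsto_finsetProd s (fun i _ => hf i)
    have hO : (fun t : ℝ => (t : ℂ) ^ k) =O[𝓝 0] fun t : ℝ => t ^ k :=
      IsBigO.of_bound 1 (Eventually.of_forall fun t => by simp)
    have small : ∀ (c : ℂ) (F : ℝ → ℂ), Tendsto F (𝓝 0) (𝓝 1) →
        (fun t : ℝ => c * (t : ℂ) ^ k * (F t - 1)) =o[𝓝 0] fun t : ℝ => t ^ k := by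
      intro c F hF
      have h1 : (fun t => F t - 1) =o[𝓝 0] fun _ => (1 : ℝ) := by
        rw [isLittleO_one_iff]
        simpa using hF.sub_const 1
      simpa using (hO.const_mul_left c).mul_isLittleO h1
    have t1 : (fun t : ℝ => (f a t - g a t - d a * (t : ℂ) ^ k) * ∏ i ∈ s, f i t) =o[𝓝 0]
        fun t : ℝ => t ^ k := by
      simpa using (h a).mul_isBigO (hprod.isBigO_one ℝ)
    have t2 : (fun t : ℝ => (∏ i ∈ s, f i t - ∏ i ∈ s, g i t - (∑ i ∈ s, d i) * (t : ℂ) ^ k) *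
        g a t) =o[𝓝 0] fun t : ℝ => t ^ k := by
      simpa using ih.mul_isBigO ((hg a).isBigO_one ℝ)
    -- Telescoping `f F - g G = (f - g) F + g (F - G)`; replacing `F` and `g` by their limit `1` in
    -- the leading terms costs only `o(tᵏ)`.
    have := ((t1.add t2).add (small (d a) _ hprod)).add (small (∑ i ∈ s, d i) _ (hg a))
    refine this.congr_left fun t => ?_
    rw [Finset.prod_insert ha, Finset.prod_insert ha, Finset.sum_insert ha]
    ring

/-- The norm of an asymptotic monomial is asymptotically equivalent to its leading term. -/
lemma isEquivalent_norm_of_isLittleO {F : ℝ → ℂ} {g : ℝ → ℝ} {w : ℂ} {k : ℕ} (hw : w ≠ 0)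
    (hF : (fun t : ℝ => F t - w * (t : ℂ) ^ k) =o[𝓝 0] fun t : ℝ => t ^ k)
    (hg : (fun t : ℝ => g t - ‖w‖ * |t| ^ k) =o[𝓝 0] fun t : ℝ => t ^ k) :
    (fun t => ‖F t‖) ~[𝓝 0] g := by
  have hw' : 0 < ‖w‖ := norm_pos_iff.2 hw
  have hO : (fun t : ℝ => t ^ k) =O[𝓝 0] fun t : ℝ => ‖w‖ * |t| ^ k := by
    refine IsBigO.of_bound ‖w‖⁻¹ (Eventually.of_forall fun t => ?_)
    simp only [norm_mul, norm_pow, Real.norm_eq_abs, abs_abs, abs_norm]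
    rw [inv_mul_cancel_left₀ hw'.ne']
  have h1 : (fun t => ‖F t‖) ~[𝓝 0] fun t : ℝ => ‖w‖ * |t| ^ k := by
    refine IsLittleO.isEquivalent ?_
    refine (IsBigO.trans_isLittleO ?_ hF).trans_isBigO hO
    refine IsBigO.of_bound 1 (Eventually.of_forall fun t => ?_)
    have : ‖w‖ * |t| ^ k = ‖w * (t : ℂ) ^ k‖ := by simp
    rw [Pi.sub_apply, this, one_mul]
    exact abs_norm_sub_norm_le _ _
  have h2 : g ~[𝓝 0] fun t : ℝ => ‖w‖ * |t| ^ k := (hg.trans_isBigO hO).isEquivalent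
  exact h1.trans h2.symm

/-! ### Standardization and convolution -/

lemma charFun_standardization (Q : Measure ℝ) (t : ℝ) :
    charFun (standardization Q) t =
      Complex.exp (-((t / sd Q : ℝ) * (∫ y, y ∂Q : ℝ) * Complex.I)) * charFun Q (t / sd Q) := by
  rw [standardization, charFun_apply_real, integral_map (by fun_prop) (by fun_prop),
    charFun_apply_real, ← integral_const_mul]
  congr 1; ext x
  rw [← Complex.exp_add]
  congr 1
  push_cast
  ring

section standardization

variable {P : Measure ℝ}

lemma InP3.memLp (hP : InP3 P) : MemLp id 2 P := by
  obtain ⟨_, hi, -⟩ := hP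
  exact (memLp_two_iff_integrable_sq (by fun_prop)).2 (integrable_sq_of_cube hi)

lemma sd_sq (P : Measure ℝ) : sd P ^ 2 = Var[id; P] := Real.sq_sqrt (variance_nonneg _ _)

lemma InP3.isProbabilityMeasure_standardization (hP : InP3 P) :
    IsProbabilityMeasure (standardization P) := by
  have := hP.1
  exact Measure.isProbabilityMeasure_map (by fun_prop)

lemma InP3.isStandard_standardization (hP : InP3 P) : IsStandard (standardization P) := by
  obtain ⟨hprob, hi, hs⟩ := id hP
  have i1 := integrable_id_of_cube hi
  constructor
  · rw [standardization, integrable_map_measure (by fun_prop) (by fun_prop)]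
    refine ((integrable_abs_add_cube hi (-∫ y, y ∂P)).div_const (sd P ^ 3)).congr
      (ae_of_all _ fun x => ?_)
    simp only [Function.comp_apply, abs_div, div_pow, abs_of_pos hs, sub_eq_add_neg]
  · rw [standardization, integral_map (by fun_prop) (by fun_prop), integral_div,
      integral_sub i1 (integrable_const _)]
    simp
  · rw [standardization, integral_map (by fun_prop) (by fun_prop)]
    simp_rw [div_pow]
    have h := sd_sq P
    rw [variance_eq_integral (by fun_prop)] at h
    simp only [id_eq] at h
    rw [integral_div, ← h, div_self (by positivity)]

lemma integral_cube_standardization (P : Measure ℝ) :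
    ∫ x, x ^ 3 ∂(standardization P) = centralMoment id 3 P / sd P ^ 3 := by
  rw [standardization, integral_map (by fun_prop) (by fun_prop), centralMoment]
  simp_rw [div_pow]
  rw [integral_div]
  rfl

lemma InP3.isTwoPoint_standardization (hP : InP3 P) (h : IsTwoPoint P) :
    IsTwoPoint (standardization P) := by
  refine h.map (by fun_prop) fun x y hxy => ?_
  have := (div_left_inj' hP.2.2.ne').1 hxy
  linarith

end standardization

section convolution

variable {n : ℕ} {P : Fin n → Measure ℝ} [∀ i, IsProbabilityMeasure (P i)]

lemma integral_id_convolution (hP : ∀ i, InP3 (P i)) :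
    ∫ y, y ∂(convolution P) = ∑ i, ∫ y, y ∂(P i) := by
  rw [convolution, integral_map (by fun_prop) (by fun_prop), integral_finsetSum]
  · exact Finset.sum_congr rfl fun i _ => integral_eval
  · exact fun i _ => integrable_eval (integrable_id_of_cube (hP i).2.1)

lemma sd_convolution (hP : ∀ i, InP3 (P i)) : sd (convolution P) = √(∑ i, sd (P i) ^ 2) := by
  rw [sd, convolution, variance_map (by fun_prop) (by fun_prop)]
  have h := variance_sum_pi (μ := P) (X := fun _ => id) fun i => (hP i).memLp
  have e : (id ∘ fun x : Fin n → ℝ => ∑ i, x i) = ∑ i, fun ω : Fin n → ℝ => id (ω i) := by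
    ext x; simp
  rw [e, h]
  simp_rw [sd_sq]

lemma charFun_standardization_convolution (hP : ∀ i, InP3 (P i)) (t : ℝ) :
    charFun (standardization (convolution P)) t =
      ∏ i, charFun (standardization (P i)) (sd (P i) * t / √(∑ i, sd (P i) ^ 2)) := by
  rw [charFun_standardization, sd_convolution hP, integral_id_convolution hP, convolution,
    charFun_map_sum_pi_eq_prod, Finset.prod_apply]
  set σ := √(∑ i, sd (P i) ^ 2)
  have h : ∀ i, sd (P i) * t / σ / sd (P i) = t / σ := fun i => by
    have := (hP i).2.2.ne'
    field_simp
  simp_rw [charFun_standardization, h]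
  rw [Finset.prod_mul_distrib, ← Complex.exp_sum]
  congr 2
  push_cast
  rw [Finset.mul_sum, Finset.sum_mul, Finset.sum_neg_distrib]

end convolution

/-! ### The bounds for sums and for a single variable, with asymptotic equality -/

/-- Third order expansion of the characteristic function of a standardized two-point law. -/
lemma IsTwoPoint.isBigO_charFun_sub_cos {Q : Measure ℝ} [IsProbabilityMeasure Q]
    (hQ : IsTwoPoint Q) (hm : ∫ x, x ∂Q = 0) (hs : ∫ x, x ^ 2 ∂Q = 1) :
    (fun t : ℝ => charFun Q t - ((Real.cos t : ℝ) : ℂ) -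
      Complex.I ^ 3 / 6 * ((∫ x, x ^ 3 ∂Q : ℝ) : ℂ) * (t : ℂ) ^ 3) =O[𝓝 0] fun t => t ^ 4 := by
  refine ((hQ.isBigO_charFun 4).sub (isTwoPoint_rademacher.isBigO_charFun 4)).congr_left
    fun t => ?_
  simp only [Finset.sum_range_succ, Finset.sum_range_zero, charFun_rademacher, pow_one, hm, hs,
    isStandard_rademacher.mean, isStandard_rademacher.second, pow_zero, integral_const,
    probReal_univ]
  have h3 : ∫ x, x ^ 3 ∂rademacher = 0 := by rw [integral_rademacher]; norm_num
  rw [h3]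
  simp only [Nat.factorial]
  push_cast
  ring

lemma isLittleO_pow_of_isBigO {F : ℝ → ℂ} {k : ℕ} (h : F =O[𝓝 0] fun t : ℝ => t ^ (k + 1)) :
    F =o[𝓝 0] fun t : ℝ => t ^ k :=
  h.trans_isLittleO (isLittleO_pow_pow (Nat.lt_succ_self k))

theorem charFun_convolution_bounds {n : ℕ} (P : Fin n → Measure ℝ)
    [∀ i, IsProbabilityMeasure (P i)] (hn : 1 ≤ n) (hP : ∀ i, InP3 (P i))
    {s ρ : Fin n → ℝ} {σ : ℝ} {φ : ℝ → ℂ} (hs : ∀ i, s i = sd (P i))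
    (hρ : ∀ i, ρ i = stdAbsThird (P i)) (hσ : σ = √(∑ i, s i ^ 2))
    (hφ : φ = charFun (standardization (convolution P))) :
    (∀ t : ℝ, ‖φ t - ((∏ i, Real.cos (s i * t / σ) : ℝ) : ℂ)‖ ≤
          |t| ^ 3 / 6 * ∑ i, s i ^ 3 * B (ρ i) / σ ^ 3) ∧
        (∀ t : ℝ, ‖φ t - 1 + (t : ℂ) ^ 2 / 2‖ ≤
          |t| ^ 3 / 6 * ∑ i, s i ^ 3 * B (ρ i) / σ ^ 3
            + t ^ 4 / 24 * ∑ i, s i ^ 4 / σ ^ 4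
            + t ^ 4 / 4 * ∑ i, ∑ j ∈ Finset.Ioi i, s i ^ 2 * s j ^ 2 / σ ^ 4) ∧
        ((∀ i, IsTwoPoint (P i)) →
          ((∀ i, 0 ≤ centralMoment id 3 (P i)) ∨ (∀ i, centralMoment id 3 (P i) ≤ 0)) →
          (fun t : ℝ => ‖φ t - ((∏ i, Real.cos (s i * t / σ) : ℝ) : ℂ)‖) ~[𝓝 0]
            (fun t : ℝ => |t| ^ 3 / 6 * ∑ i, s i ^ 3 * B (ρ i) / σ ^ 3)) := by
  obtain rfl : s = fun i => sd (P i) := funext hs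
  obtain rfl : ρ = fun i => ∫ x, |x| ^ 3 ∂(standardization (P i)) := funext hρ
  have hspos : ∀ i, 0 < sd (P i) := fun i => (hP i).2.2
  have hprob : ∀ i, IsProbabilityMeasure (standardization (P i)) := fun i =>
    (hP i).isProbabilityMeasure_standardization
  have hstd : ∀ i, IsStandard (standardization (P i)) := fun i =>
    (hP i).isStandard_standardization
  have hsum : 0 < ∑ i, sd (P i) ^ 2 :=
    Finset.sum_pos (fun i _ => by have := hspos i; positivity) ⟨⟨0, hn⟩, Finset.mem_univ _⟩
  have hσ0 : 0 < σ := by rw [hσ]; exact Real.sqrt_pos.2 hsum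
  have hσ2 : σ ^ 2 = ∑ i, sd (P i) ^ 2 := by rw [hσ]; exact Real.sq_sqrt hsum.le
  have hφt : ∀ t, φ t = ∏ i, charFun (standardization (P i)) (sd (P i) * t / σ) := fun t => by
    rw [hφ, charFun_standardization_convolution hP, ← hσ]
  have hfirst : ∀ t : ℝ, ‖φ t - ((∏ i, Real.cos (sd (P i) * t / σ) : ℝ) : ℂ)‖ ≤
      |t| ^ 3 / 6 * ∑ i, sd (P i) ^ 3 * B (∫ x, |x| ^ 3 ∂(standardization (P i))) / σ ^ 3 := by
    intro t
    rw [hφt, Complex.ofReal_prod]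
    refine (norm_prod_sub_prod_le _ _ _ (fun i => norm_charFun_le_one _) fun i => ?_).trans ?_
    · rw [Complex.norm_real]; exact Real.abs_cos_le_one _
    rw [Finset.mul_sum]
    refine Finset.sum_le_sum fun i _ => ((hstd i).norm_charFun_sub_cos_le _).trans_eq ?_
    rw [abs_div, abs_mul, abs_of_pos hσ0, abs_of_pos (hspos i)]
    field_simp
  refine ⟨hfirst, fun t => ?_, fun htwo hsign => ?_⟩
  · have h2 := abs_prod_cos_sub_one_add_le fun i => sd (P i) * t / σ
    have e1 : ∑ i, (sd (P i) * t / σ) ^ 2 = t ^ 2 := by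
      have : ∀ i, (sd (P i) * t / σ) ^ 2 = sd (P i) ^ 2 * (t ^ 2 / σ ^ 2) := fun i => by ring
      simp_rw [this]
      rw [← Finset.sum_mul, ← hσ2]
      field_simp
    have e2 : 1 / 24 * ∑ i, (sd (P i) * t / σ) ^ 4 = t ^ 4 / 24 * ∑ i, sd (P i) ^ 4 / σ ^ 4 := by
      rw [Finset.mul_sum, Finset.mul_sum]
      exact Finset.sum_congr rfl fun i _ => by ring
    have e3 : 1 / 4 * ∑ i, ∑ j ∈ Finset.Ioi i, (sd (P i) * t / σ) ^ 2 * (sd (P j) * t / σ) ^ 2 =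
        t ^ 4 / 4 * ∑ i, ∑ j ∈ Finset.Ioi i, sd (P i) ^ 2 * sd (P j) ^ 2 / σ ^ 4 := by
      simp_rw [Finset.mul_sum]
      exact Finset.sum_congr rfl fun i _ => Finset.sum_congr rfl fun j _ => by ring
    rw [e1, e2, e3] at h2
    have e4 : φ t - 1 + (t : ℂ) ^ 2 / 2 = (φ t - ((∏ i, Real.cos (sd (P i) * t / σ) : ℝ) : ℂ)) +
        ((∏ i, Real.cos (sd (P i) * t / σ) - 1 + t ^ 2 / 2 : ℝ) : ℂ) := by
      push_cast; ring
    rw [e4, add_assoc]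
    refine (norm_add_le _ _).trans (add_le_add (hfirst t) ?_)
    rw [Complex.norm_real]
    exact h2
  · set m : Fin n → ℝ := fun i => ∫ x, x ^ 3 ∂(standardization (P i)) with hm
    have hB : ∀ i, B (∫ x, |x| ^ 3 ∂(standardization (P i))) = |m i| := fun i =>
      ((hP i).isTwoPoint_standardization (htwo i)).B_eq (hstd i).mean (hstd i).second
    set d : Fin n → ℂ := fun i => Complex.I ^ 3 / 6 * ((sd (P i) ^ 3 * m i / σ ^ 3 : ℝ) : ℂ) with hd
    have hnorm : ‖∑ i, d i‖ = 1 / 6 * ∑ i, sd (P i) ^ 3 * |m i| / σ ^ 3 := by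
      have hmi : ∀ i, m i = centralMoment id 3 (P i) / sd (P i) ^ 3 := fun i =>
        integral_cube_standardization (P i)
      rw [← Finset.mul_sum, ← Complex.ofReal_sum, norm_mul, Complex.norm_real, Real.norm_eq_abs]
      congr 1
      · simp
      -- The coefficients `d i` are real multiples, all of one sign, of one complex number, so the
      -- triangle inequality is an equality.
      · rcases hsign with h | h
        · have hm0 : ∀ i, 0 ≤ m i := fun i => by
            rw [hmi]; exact div_nonneg (h i) (pow_nonneg (hspos i).le 3)
          rw [abs_of_nonneg (Finset.sum_nonneg fun i _ => div_nonneg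
            (mul_nonneg (pow_nonneg (hspos i).le 3) (hm0 i)) (pow_nonneg hσ0.le 3))]
          exact Finset.sum_congr rfl fun i _ => by rw [abs_of_nonneg (hm0 i)]
        · have hm0 : ∀ i, m i ≤ 0 := fun i => by
            rw [hmi]; exact div_nonpos_of_nonpos_of_nonneg (h i) (pow_nonneg (hspos i).le 3)
          rw [abs_of_nonpos (Finset.sum_nonpos fun i _ => div_nonpos_of_nonpos_of_nonneg
            (mul_nonpos_of_nonneg_of_nonpos (pow_nonneg (hspos i).le 3) (hm0 i))
            (pow_nonneg hσ0.le 3)), ← Finset.sum_neg_distrib]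
          exact Finset.sum_congr rfl fun i _ => by rw [abs_of_nonpos (hm0 i)]; ring
    simp only [hB] at hfirst ⊢
    -- There is no leading term here: the right side is identically zero, and by the first bound so
    -- is the left.
    by_cases hw : ∑ i, d i = 0
    · rw [hw, norm_zero] at hnorm
      have h0 : ∑ i, sd (P i) ^ 3 * |m i| / σ ^ 3 = 0 := by linarith
      rw [h0] at hfirst ⊢
      refine IsEquivalent.refl.congr_left (Eventually.of_forall fun t => ?_)
      have := hfirst t
      rw [mul_zero] at this
      simp only [mul_zero]
      exact (le_antisymm this (norm_nonneg _)).symm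
    refine isEquivalent_norm_of_isLittleO (k := 3) hw ?_ ?_
    · have hlim : ∀ i, Tendsto (fun t : ℝ => sd (P i) * t / σ) (𝓝 0) (𝓝 0) := fun i => by
        have : Continuous fun t : ℝ => sd (P i) * t / σ := by fun_prop
        simpa using this.tendsto 0
      refine (isLittleO_prod_sub_prod Finset.univ
        (fun i t => charFun (standardization (P i)) (sd (P i) * t / σ))
        (fun i t => ((Real.cos (sd (P i) * t / σ) : ℝ) : ℂ)) d 3 (fun i => ?_) (fun i => ?_)
        fun i => ?_).congr_left fun t => ?_
      · have hc : Tendsto (charFun (standardization (P i))) (𝓝 0) (𝓝 1) := by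
          have := (continuous_charFun (μ := standardization (P i))).tendsto 0
          simpa using this
        exact hc.comp (hlim i)
      · have : Continuous fun t : ℝ => ((Real.cos (sd (P i) * t / σ) : ℝ) : ℂ) := by fun_prop
        simpa using this.tendsto 0
      · refine isLittleO_pow_of_isBigO ?_
        have h4 := (((hP i).isTwoPoint_standardization (htwo i)).isBigO_charFun_sub_cos
          (hstd i).mean (hstd i).second).comp_tendsto (hlim i)
        have h5 : ((fun t : ℝ => t ^ 4) ∘ fun t : ℝ => sd (P i) * t / σ) =O[𝓝 0]
            fun t : ℝ => t ^ (3 + 1) := by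
          refine ((isBigO_refl (fun t : ℝ => t ^ 4) (𝓝 0)).const_mul_left
            ((sd (P i) / σ) ^ 4)).congr_left fun t => ?_
          simp only [Function.comp_apply]; ring
        refine (h4.trans h5).congr_left fun t => ?_
        simp only [Function.comp_apply, hd, hm]
        push_cast
        ring
      · simp only [hφt, Complex.ofReal_prod]
    · refine (isLittleO_zero _ _).congr_left fun t => ?_
      rw [hnorm]; ring

theorem charFun_standard_bounds {Q : Measure ℝ} [IsProbabilityMeasure Q] (hQ : IsStandard Q) :
    (∀ t : ℝ, ‖charFun Q t - 1 + (t : ℂ) ^ 2 / 2‖ ≤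
      A (∫ x, |x| ^ 3 ∂Q) * ((∫ x, |x| ^ 3 ∂Q) * |t| ^ 3 / 6) + t ^ 4 / 24) ∧
    (IsTwoPoint Q → (fun t : ℝ => ‖charFun Q t - 1 + (t : ℂ) ^ 2 / 2‖) ~[𝓝 0]
      fun t : ℝ => A (∫ x, |x| ^ 3 ∂Q) * ((∫ x, |x| ^ 3 ∂Q) * |t| ^ 3 / 6) + t ^ 4 / 24) := by
  have hρ : (∫ x, |x| ^ 3 ∂Q) ≠ 0 := (zero_lt_one.trans_le (one_le_third_moment hQ)).ne'
  have hA : ∀ t : ℝ, A (∫ x, |x| ^ 3 ∂Q) * ((∫ x, |x| ^ 3 ∂Q) * |t| ^ 3 / 6) =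
      |t| ^ 3 / 6 * B (∫ x, |x| ^ 3 ∂Q) := fun t => by
    rw [A]; field_simp
  simp_rw [hA]
  refine ⟨fun t => ?_, fun h2 => ?_⟩
  · have e : charFun Q t - 1 + (t : ℂ) ^ 2 / 2 = (charFun Q t - ((Real.cos t : ℝ) : ℂ)) +
        ((Real.cos t - 1 + t ^ 2 / 2 : ℝ) : ℂ) := by push_cast; ring
    rw [e]
    refine (norm_add_le _ _).trans (add_le_add (hQ.norm_charFun_sub_cos_le t) ?_)
    rw [Complex.norm_real]
    exact abs_cos_sub_one_add_sq_le t
  · have hB := h2.B_eq hQ.mean hQ.second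
    -- If the third moment vanishes, then `B = 0` forces the cosine, and `t⁴/24` is the leading
    -- term. Otherwise the cubic term dominates and `t⁴/24` is negligible.
    by_cases h3 : ∫ x, x ^ 3 ∂Q = 0
    · rw [h3, abs_zero] at hB
      have hcos : ∀ t, charFun Q t = charFun rademacher t := fun t => by
        have := hQ.norm_charFun_sub_cos_le t
        rw [hB, mul_zero] at this
        rw [charFun_rademacher]
        exact sub_eq_zero.1 (norm_eq_zero.1 (le_antisymm this (norm_nonneg _)))
      simp_rw [hcos, hB]
      refine isEquivalent_norm_of_isLittleO (w := 1 / 24) (k := 4) (by norm_num) ?_ ?_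
      · refine isLittleO_pow_of_isBigO ((isTwoPoint_rademacher.isBigO_charFun 5).congr_left
          fun t => ?_)
        have r3 : ∫ x, x ^ 3 ∂rademacher = 0 := by rw [integral_rademacher]; norm_num
        have r4 : ∫ x, x ^ 4 ∂rademacher = 1 := by rw [integral_rademacher]; norm_num
        simp only [Finset.sum_range_succ, Finset.sum_range_zero, pow_one, r3, r4,
          isStandard_rademacher.mean, isStandard_rademacher.second, pow_zero, integral_const,
          probReal_univ, smul_eq_mul, mul_one, Complex.ofReal_one, mul_pow, Complex.I_sq, Complex.I_pow_four]
        simp only [Nat.factorial]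
        push_cast
        ring
      · refine (isLittleO_zero _ _).congr_left fun t => ?_
        rw [Even.pow_abs (by decide : Even 4)]
        norm_num
        ring
    · refine isEquivalent_norm_of_isLittleO
        (w := Complex.I ^ 3 / 6 * ((∫ x, x ^ 3 ∂Q : ℝ) : ℂ)) (k := 3) ?_ ?_ ?_
      · simp [h3]
      · refine isLittleO_pow_of_isBigO ((h2.isBigO_charFun 4).congr_left fun t => ?_)
        simp only [Finset.sum_range_succ, Finset.sum_range_zero, pow_one, hQ.mean, hQ.second,
          pow_zero, integral_const, probReal_univ, smul_eq_mul, mul_one, Complex.ofReal_one, mul_pow, Complex.I_sq]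
        simp only [Nat.factorial]
        push_cast
        ring
      · have h4 : (fun t : ℝ => 1 / 24 * t ^ 4) =o[𝓝 0] fun t : ℝ => t ^ 3 :=
          (isLittleO_pow_pow (by norm_num)).const_mul_left _
        refine h4.congr_left fun t => ?_
        rw [hB, norm_mul, Complex.norm_real, Real.norm_eq_abs]
        simp only [norm_div, norm_pow, Complex.norm_I]
        norm_num
        ring

end BerryEsseenSmooth

theorem mainTheorem8 :
    (∀ (n : ℕ) (P : Fin n → Measure ℝ) [∀ i, IsProbabilityMeasure (P i)],
      1 ≤ n → (∀ i, BerryEsseenSmooth.InP3 (P i)) →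
      ∀ (s ρ : Fin n → ℝ) (σ : ℝ) (φ : ℝ → ℂ),
        (∀ i, s i = BerryEsseenSmooth.sd (P i)) →
        (∀ i, ρ i = BerryEsseenSmooth.stdAbsThird (P i)) →
        σ = √(∑ i, s i ^ 2) →
        φ = charFun (BerryEsseenSmooth.standardization (BerryEsseenSmooth.convolution P)) →
        (∀ t : ℝ, ‖φ t - ((∏ i, Real.cos (s i * t / σ) : ℝ) : ℂ)‖ ≤
          |t| ^ 3 / 6 * ∑ i, s i ^ 3 * BerryEsseenSmooth.B (ρ i) / σ ^ 3) ∧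
        (∀ t : ℝ, ‖φ t - 1 + (t : ℂ) ^ 2 / 2‖ ≤
          |t| ^ 3 / 6 * ∑ i, s i ^ 3 * BerryEsseenSmooth.B (ρ i) / σ ^ 3
            + t ^ 4 / 24 * ∑ i, s i ^ 4 / σ ^ 4
            + t ^ 4 / 4 * ∑ i, ∑ j ∈ Finset.Ioi i, s i ^ 2 * s j ^ 2 / σ ^ 4) ∧
        ((∀ i, BerryEsseenSmooth.IsTwoPoint (P i)) →
          ((∀ i, 0 ≤ centralMoment id 3 (P i)) ∨ (∀ i, centralMoment id 3 (P i) ≤ 0)) →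
          (fun t : ℝ => ‖φ t - ((∏ i, Real.cos (s i * t / σ) : ℝ) : ℂ)‖) ~[𝓝 0]
            (fun t : ℝ => |t| ^ 3 / 6 * ∑ i, s i ^ 3 * BerryEsseenSmooth.B (ρ i) / σ ^ 3))) ∧
    (∀ {Ω : Type*} [MeasurableSpace Ω] (μ : Measure Ω) [IsProbabilityMeasure μ] (X : Ω → ℝ),
      AEMeasurable X μ → Integrable (fun ω => |X ω| ^ 3) μ →
      ∫ ω, X ω ∂μ = 0 → ∫ ω, X ω ^ 2 ∂μ = 1 →
      ∀ ρ : ℝ, ρ = ∫ ω, |X ω| ^ 3 ∂μ →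
        (∀ t : ℝ, ‖∫ ω, Complex.exp (Complex.I * t * X ω) ∂μ - 1 + (t : ℂ) ^ 2 / 2‖ ≤
          BerryEsseenSmooth.A ρ * (ρ * |t| ^ 3 / 6) + t ^ 4 / 24) ∧
        (BerryEsseenSmooth.IsTwoPoint (μ.map X) ↔
          (μ.map X = BerryEsseenSmooth.PRho ρ ∨
            μ.map (fun ω => -X ω) = BerryEsseenSmooth.PRho ρ)) ∧
        (BerryEsseenSmooth.IsTwoPoint (μ.map X) →
          (fun t : ℝ => ‖∫ ω, Complex.exp (Complex.I * t * X ω) ∂μ - 1 + (t : ℂ) ^ 2 / 2‖) ~[𝓝 0]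
            (fun t : ℝ => BerryEsseenSmooth.A ρ * (ρ * |t| ^ 3 / 6) + t ^ 4 / 24))) := by
  refine ⟨fun n P _ hn hP s ρ σ φ hs hρ hσ hφ =>
    BerryEsseenSmooth.charFun_convolution_bounds P hn hP hs hρ hσ hφ, ?_⟩
  intro Ω _ μ _ X hX hi hm hv ρ hρ
  have hprob : IsProbabilityMeasure (μ.map X) := Measure.isProbabilityMeasure_map hX
  have hm' : ∫ x, x ∂(μ.map X) = 0 := by rw [integral_map hX (by fun_prop), hm]
  have hv' : ∫ x, x ^ 2 ∂(μ.map X) = 1 := by rw [integral_map hX (by fun_prop), hv]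
  have hρ' : ρ = ∫ x, |x| ^ 3 ∂(μ.map X) := by rw [integral_map hX (by fun_prop), hρ]
  have hQ : BerryEsseenSmooth.IsStandard (μ.map X) :=
    ⟨(integrable_map_measure (by fun_prop) hX).2 hi, hm', hv'⟩
  have hφ : ∀ t : ℝ, ∫ ω, Complex.exp (Complex.I * t * X ω) ∂μ = charFun (μ.map X) t := fun t => by
    rw [charFun_apply_real, integral_map hX (by fun_prop)]
    congr 1; ext ω
    congr 1; ring
  have hneg : μ.map (fun ω => -X ω) = (μ.map X).map (fun x => -x) := by
    rw [AEMeasurable.map_map_of_aemeasurable (by fun_prop) hX]; rfl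
  obtain ⟨h1, h2⟩ := BerryEsseenSmooth.charFun_standard_bounds hQ
  simp_rw [hφ, hneg, hρ']
  exact ⟨h1, BerryEsseenSmooth.isTwoPoint_iff_PRho hm' hv', h2⟩
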